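/- For a finitely generated group $G$ and a finite generating set $S$ of $G$, let $\ell_{G,S}(g)$ be the minimal $n$ such that $g = x_1x_2\cdots x_n$ with all $x_i\in S\cup S^{-1}$, let $F_{G,S}(n)$ be the number of $g\in G$ with $\ell_{G,S}(g)\le n$, let $\omega(G,S)=\lim_{n\to\infty}F_{G,S}(n)^{1/n}$ (this limit exists), and let $\Omega(G)=\inf_S\omega(G,S)$, the infimum over all finite generating sets $S$ of $G$. Theorem. Let $G=A*_C B$ be the amalgamated product of two groups $A$ and $B$ over a common subgroup $C$, and suppose that $G$ is finitely generated. If $([A:C]-1)([B:C]-1)\ge 2$ (the indices may be infinite, with $\infty\cdot 0=0$ and $\infty\cdot k=\infty$ for $k\neq 0$), then $\Omega(G)\ge\alpha$, where $\alpha$ is the plastic number, the unique positive real root of $z^3-z-1$. -/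

import Mathlib

open Filter Topology

universe u v

/-! ### Word length and exponential growth rate -/

/-- The word length of `g` with respect to `S`: the least `n` such that `g = x₁ x₂ ⋯ xₙ` with all
`xᵢ ∈ S ∪ S⁻¹` (and `⊤` if `g` is not in the subgroup generated by `S`). -/
noncomputable def wordLength {G : Type*} [Group G] (S : Set G) (g : G) : ℕ∞ :=
  ⨅ (l : List G) (_ : (∀ x ∈ l, x ∈ S ∨ x⁻¹ ∈ S) ∧ l.prod = g), (l.length : ℕ∞)

/-- The growth function: the number of elements of word length at most `n`. -/
noncomputable def growthFunction {G : Type*} [Group G] (S : Set G) (n : ℕ) : ℕ :=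
  {g : G | wordLength S g ≤ n}.ncard

/-- The exponential growth rate `ω(G, S) = lim F(n)^(1/n)`. The limit exists for every finite `S`:
see `tendsto_growthRate`. -/
noncomputable def growthRate {G : Type*} [Group G] (S : Set G) : ℝ :=
  limUnder atTop (fun n : ℕ => (growthFunction S n : ℝ) ^ (1 / (n : ℝ)))

/-- The minimal exponential growth rate `Ω(G)` of a finitely generated group `G`: the infimum of
`ω(G, S)` over all finite generating sets `S`. -/
noncomputable def minGrowthRate (G : Type*) [Group G] : ℝ :=
  sInf {r : ℝ | ∃ S : Set G, S.Finite ∧ Subgroup.closure S = ⊤ ∧ r = growthRate S}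

theorem wordLength_le_iff {G : Type*} [Group G] {S : Set G} {g : G} {n : ℕ} :
    wordLength S g ≤ n ↔
      ∃ l : List G, (∀ x ∈ l, x ∈ S ∨ x⁻¹ ∈ S) ∧ l.prod = g ∧ l.length ≤ n := by
  constructor
  · intro h
    by_contra! hc
    have h1 : ((n + 1 : ℕ) : ℕ∞) ≤ wordLength S g :=
      le_iInf fun l => le_iInf fun hl => by exact_mod_cast hc l hl.1 hl.2
    have h2 : ((n + 1 : ℕ) : ℕ∞) ≤ (n : ℕ∞) := h1.trans h
    have h3 : n + 1 ≤ n := by exact_mod_cast h2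
    omega
  · rintro ⟨l, hl, hg, hn⟩
    exact (iInf₂_le l ⟨hl, hg⟩).trans (by exact_mod_cast hn)

theorem finite_wordLength_le {G : Type*} [Group G] {S : Set G} (hS : S.Finite) (n : ℕ) :
    {g : G | wordLength S g ≤ n}.Finite := by
  have hT : (S ∪ S⁻¹).Finite := hS.union hS.inv
  have : Finite ↥(S ∪ S⁻¹) := hT
  refine ((List.finite_length_le (↥(S ∪ S⁻¹)) n).image
    (fun l => (l.map Subtype.val).prod)).subset ?_
  intro g hg
  obtain ⟨l, hl, rfl, hn⟩ := wordLength_le_iff.1 hg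
  refine ⟨l.attach.map (fun x => ⟨x.1, by simpa using hl x.1 x.2⟩), by simpa using hn, ?_⟩
  simp [Function.comp_def]

theorem one_le_growthFunction {G : Type*} [Group G] {S : Set G} (hS : S.Finite) (n : ℕ) :
    1 ≤ growthFunction S n :=
  (Set.ncard_pos (finite_wordLength_le hS n)).2
    ⟨1, wordLength_le_iff.2 ⟨[], by simp, by simp, by simp⟩⟩

theorem growthFunction_add_le {G : Type*} [Group G] {S : Set G} (hS : S.Finite) (m n : ℕ) :
    growthFunction S (m + n) ≤ growthFunction S m * growthFunction S n := by
  have hm := finite_wordLength_le hS m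
  have hn := finite_wordLength_le hS n
  unfold growthFunction
  rw [← Set.ncard_prod]
  refine le_trans (Set.ncard_le_ncard ?_ ((hm.prod hn).image (fun p : G × G => p.1 * p.2)))
    (Set.ncard_image_le (hm.prod hn))
  intro g hg
  obtain ⟨l, hl, rfl, hlen⟩ := wordLength_le_iff.1 hg
  refine ⟨((l.take m).prod, (l.drop m).prod), ⟨?_, ?_⟩, by simp [List.prod_take_mul_prod_drop]⟩
  · exact wordLength_le_iff.2 ⟨l.take m, fun x hx => hl x (List.mem_of_mem_take hx), rfl, by simp⟩
  · exact wordLength_le_iff.2 ⟨l.drop m, fun x hx => hl x (List.mem_of_mem_drop hx), rfl,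
      by simp; omega⟩

/-- The limit defining the exponential growth rate exists. -/
theorem tendsto_growthRate {G : Type*} [Group G] {S : Set G} (hS : S.Finite) :
    Tendsto (fun n : ℕ => (growthFunction S n : ℝ) ^ (1 / (n : ℝ))) atTop (𝓝 (growthRate S)) := by
  have hpos : ∀ n, (0 : ℝ) < growthFunction S n := fun n => by
    exact_mod_cast one_le_growthFunction hS n
  have hsub : Subadditive (fun n => Real.log (growthFunction S n)) := by
    intro m n
    rw [← Real.log_mul (hpos m).ne' (hpos n).ne']
    exact Real.log_le_log (hpos _) (by exact_mod_cast growthFunction_add_le hS m n)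
  have hbdd : BddBelow (Set.range fun n : ℕ => Real.log (growthFunction S n) / n) := by
    refine ⟨0, ?_⟩
    rintro _ ⟨n, rfl⟩
    have : (1 : ℝ) ≤ growthFunction S n := by exact_mod_cast one_le_growthFunction hS n
    exact div_nonneg (Real.log_nonneg this) (Nat.cast_nonneg n)
  have key := (Real.continuous_exp.tendsto _).comp (hsub.tendsto_lim hbdd)
  refine tendsto_nhds_limUnder ⟨_, key.congr fun n => ?_⟩
  rw [Real.rpow_def_of_pos (hpos n)]
  simp [div_eq_mul_inv]

/-! ### Amalgamated products -/

/-- The family of two types `A`, `B`. -/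
def AmalgamFactor (A B : Type u) : Bool → Type u
  | false => A
  | true => B

instance AmalgamFactor.group {A B : Type u} [Group A] [Group B] : ∀ b, Group (AmalgamFactor A B b)
  | false => inferInstanceAs (Group A)
  | true => inferInstanceAs (Group B)

/-- The family consisting of the two homomorphisms `C → A` and `C → B`. -/
def amalgamMap {A B : Type u} {C : Type v} [Group A] [Group B] [Group C] (φ : C →* A) (ψ : C →* B) :
    ∀ b, C →* AmalgamFactor A B b
  | false => φ
  | true => ψ

/-- The amalgamated product `A *_C B` along `φ : C → A` and `ψ : C → B` (meant for injective
`φ`, `ψ`), as the pushout of groups. -/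
abbrev AmalgamatedProduct {A B : Type u} {C : Type v} [Group A] [Group B] [Group C]
    (φ : C →* A) (ψ : C →* B) : Type (max u v) :=
  Monoid.PushoutI (amalgamMap φ ψ)

/-! ### The plastic number -/

theorem existsUnique_plastic : ∃! z : ℝ, 0 < z ∧ z ^ 3 - z - 1 = 0 := by
  have hc : ContinuousOn (fun z : ℝ => z ^ 3 - z - 1) (Set.Icc 1 2) := by fun_prop
  obtain ⟨z, hz, h0⟩ := intermediate_value_Icc (by norm_num : (1 : ℝ) ≤ 2) hc
    (show (0 : ℝ) ∈ Set.Icc _ _ by constructor <;> norm_num)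
  have h0 : z ^ 3 - z - 1 = 0 := h0
  refine ⟨z, ⟨by linarith [hz.1], h0⟩, ?_⟩
  rintro y ⟨hy, hy0⟩
  have h1 : (y - z) * (y ^ 2 + y * z + z ^ 2 - 1) = 0 := by linear_combination hy0 - h0
  rcases mul_eq_zero.1 h1 with h | h
  · linarith
  · nlinarith [hz.1, mul_pos hy (by linarith [hz.1] : 0 < z), sq_nonneg y]

/-- The plastic number: the unique positive root of `z ^ 3 - z - 1`. -/
noncomputable def plasticNumber : ℝ := existsUnique_plastic.choose

theorem plasticNumber_spec : 0 < plasticNumber ∧ plasticNumber ^ 3 - plasticNumber - 1 = 0 :=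
  existsUnique_plastic.choose_spec.1

/-! The growth bound comes from free semigroups. If `g` and `h` have length at most 2 and 3 and play
ping-pong, the elements of length at most n in the semigroup they generate satisfy f(n+3) ≥ f(n+1) +
f(n), with characteristic polynomial z³ - z - 1. So for every finite generating set S it suffices to
find such a pair, using the action on the Bass-Serre tree
(`IsHalfspaceSystem.plasticNumber_le_growthRate`).

Suppose there is none. Hyperbolic elements with different axes play ping-pong up to inversion
(`exists_pingPong_of_axis_ne`), so a hyperbolic element of length at most 2 has the same axis as any
hyperbolic element of length at most 3. No axis is preserved by all of S, because the tree is not a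
line (`exists_smul_axis_ne`). A hyperbolic s in S would share its axis with every usu⁻¹, so every u
in S would preserve it; hence all generators are elliptic. Then some edge separates the fixed points
of generators s and t (`exists_separating`), and st is hyperbolic with this edge on its axis. Some u
in S moves that axis. If u fixes the edge, then (st)^±1 and its product with u or u⁻¹ play ping-pong
(`pingPong_mul`). Otherwise su or ut is hyperbolic with the same axis as st; su and us are conjugate
by u and share their axis, so u preserves it (likewise for ut), a contradiction.

The tree itself is never built. Its halfspaces are subsets of G: the reduced words starting in a
factor where C has index at least 3, with translates and complements. -/

open scoped Pointwise

/-! ### Free subsemigroups and growth -/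

section Growth

variable {G : Type*} [Group G] {S : Set G} {g h : G}

theorem wordLength_mul_le {m n : ℕ} (hg : wordLength S g ≤ m) (hh : wordLength S h ≤ n) :
    wordLength S (g * h) ≤ (m + n : ℕ) := by
  obtain ⟨l, hl, rfl, hlm⟩ := wordLength_le_iff.1 hg
  obtain ⟨k, hk, rfl, hkn⟩ := wordLength_le_iff.1 hh
  refine wordLength_le_iff.2 ⟨l ++ k, ?_, by simp, by simp; omega⟩
  intro x hx
  rcases List.mem_append.1 hx with hx | hx
  exacts [hl x hx, hk x hx]

theorem wordLength_inv_le {n : ℕ} (hg : wordLength S g ≤ n) : wordLength S g⁻¹ ≤ n := by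
  obtain ⟨l, hl, rfl, hn⟩ := wordLength_le_iff.1 hg
  refine wordLength_le_iff.2 ⟨(l.map (·⁻¹)).reverse, ?_, by rw [List.prod_inv_reverse], by simpa⟩
  intro x hx
  simp only [List.mem_reverse, List.mem_map] at hx
  obtain ⟨y, hy, rfl⟩ := hx
  simpa using (hl y hy).symm

theorem wordLength_le_one (hg : g ∈ S) : wordLength S g ≤ (1 : ℕ) :=
  wordLength_le_iff.2 ⟨[g], by simpa using Or.inl hg, by simp, by simp⟩

theorem wordLength_le_of_le {m n : ℕ} (hg : wordLength S g ≤ m) (hmn : m ≤ n) :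
    wordLength S g ≤ n :=
  hg.trans (by exact_mod_cast hmn)

/-- `g` and `h` play ping-pong on `V` in the sense that guarantees that they freely generate a
free semigroup. -/
def PingPong (V : Type*) [MulAction G V] (g h : G) : Prop :=
  ∃ D E : Set V, Disjoint D E ∧ D.Nonempty ∧
    g • D ⊆ D ∧ g • E ⊆ D ∧ h • D ⊆ E ∧ h • E ⊆ E

theorem PingPong.symm {V : Type*} [MulAction G V] (hp : PingPong V g h) : PingPong V h g := by
  obtain ⟨D, E, hd, hD, h1, h2, h3, h4⟩ := hp
  exact ⟨E, D, hd.symm, hD.smul_set.mono h3, h4, h3, h2, h1⟩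

/-- Applied to a point of D, every element of the semigroup lands in D ∪ E, and its first letter
decides which. This is all of freeness that the counting needs. -/
theorem PingPong.mul_ne_mul {V : Type*} [MulAction G V] (hp : PingPong V g h) {x y : G}
    (hx : x ∈ Submonoid.closure {g, h}) (hy : y ∈ Submonoid.closure {g, h}) :
    g * x ≠ h * y := by
  obtain ⟨D, E, hd, ⟨v, hv⟩, h1, h2, h3, h4⟩ := hp
  have key : ∀ z ∈ Submonoid.closure {g, h}, z • v ∈ D ∪ E := by
    intro z hz
    induction hz using Submonoid.closure_induction_left with
    | one => simpa using Or.inl hv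
    | mul_left a ha z _ ih =>
      rw [mul_smul]
      rcases ha with rfl | rfl
      · exact Or.inl (ih.elim (fun i => h1 (Set.smul_mem_smul_set i))
          (fun i => h2 (Set.smul_mem_smul_set i)))
      · exact Or.inr (ih.elim (fun i => h3 (Set.smul_mem_smul_set i))
          (fun i => h4 (Set.smul_mem_smul_set i)))
  intro he
  have hgx : (g * x) • v ∈ D := by
    rw [mul_smul]
    exact (key x hx).elim (fun i => h1 (Set.smul_mem_smul_set i))
          (fun i => h2 (Set.smul_mem_smul_set i))
  have hhy : (h * y) • v ∈ E := by
    rw [mul_smul]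
    exact (key y hy).elim (fun i => h3 (Set.smul_mem_smul_set i))
          (fun i => h4 (Set.smul_mem_smul_set i))
  exact Set.disjoint_left.1 hd hgx (he ▸ hhy)

/-- The elements of length at most `n` of the semigroup generated by `g` and `h`. -/
def semigroupBall (S : Set G) (g h : G) (n : ℕ) : Set G :=
  {x | x ∈ Submonoid.closure {g, h} ∧ wordLength S x ≤ n}

theorem finite_semigroupBall (hS : S.Finite) (n : ℕ) : (semigroupBall S g h n).Finite :=
  (finite_wordLength_le hS n).subset fun _ hx => hx.2

/-- The left translates by `g` and `h` are disjoint and raise the length by at most 2 and 3. These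
two numbers are the source of z³ = z + 1. -/
theorem PingPong.ncard_semigroupBall_le {V : Type*} [MulAction G V] (hp : PingPong V g h)
    (hS : S.Finite) (hg : wordLength S g ≤ (2 : ℕ)) (hh : wordLength S h ≤ (3 : ℕ)) (n : ℕ) :
    (semigroupBall S g h (n + 1)).ncard + (semigroupBall S g h n).ncard ≤
      (semigroupBall S g h (n + 3)).ncard := by
  have hgm : g ∈ Submonoid.closure {g, h} := Submonoid.subset_closure (by simp)
  have hhm : h ∈ Submonoid.closure {g, h} := Submonoid.subset_closure (by simp)
  rw [← Set.ncard_smul_set g (semigroupBall S g h (n + 1)),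
    ← Set.ncard_smul_set h (semigroupBall S g h n), ← Set.ncard_union_eq ?_
      (finite_semigroupBall hS _).smul_set (finite_semigroupBall hS _).smul_set]
  · refine Set.ncard_le_ncard ?_ (finite_semigroupBall hS _)
    rintro _ (⟨x, hx, rfl⟩ | ⟨x, hx, rfl⟩)
    · exact ⟨mul_mem hgm hx.1, wordLength_le_of_le (wordLength_mul_le hg hx.2) (by omega)⟩
    · exact ⟨mul_mem hhm hx.1, wordLength_le_of_le (wordLength_mul_le hh hx.2) (by omega)⟩
  · rw [Set.disjoint_left]
    rintro _ ⟨x, hx, rfl⟩ ⟨y, hy, he⟩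
    exact hp.mul_ne_mul hx.1 hy.1 he.symm

theorem one_lt_plasticNumber : 1 < plasticNumber := by
  obtain ⟨h0, h1⟩ := plasticNumber_spec
  by_contra! hc
  nlinarith [mul_nonneg h0.le (sub_nonneg.2 hc), mul_nonneg (mul_nonneg h0.le h0.le)
    (sub_nonneg.2 hc)]

theorem PingPong.pow_le_ncard_semigroupBall {V : Type*} [MulAction G V] (hp : PingPong V g h)
    (hS : S.Finite) (hg : wordLength S g ≤ (2 : ℕ)) (hh : wordLength S h ≤ (3 : ℕ)) (n : ℕ) :
    plasticNumber ^ n ≤ plasticNumber ^ 2 * (semigroupBall S g h n).ncard := by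
  have h1 := one_lt_plasticNumber
  have hone : ∀ n, (1 : ℝ) ≤ (semigroupBall S g h n).ncard := fun n => by
    have : 0 < (semigroupBall S g h n).ncard := (Set.ncard_pos (finite_semigroupBall hS n)).2
      ⟨1, one_mem _, wordLength_le_iff.2 ⟨[], by simp, by simp, by simp⟩⟩
    exact_mod_cast this
  -- The factor `plasticNumber ^ 2` absorbs the three initial values of the recursion; it disappears
  -- on taking n-th roots.
  have hsmall : ∀ n ≤ 2, plasticNumber ^ n ≤ plasticNumber ^ 2 * (semigroupBall S g h n).ncard :=
    fun n hn => (pow_le_pow_right₀ h1.le hn).trans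
      (le_mul_of_one_le_right (by positivity) (hone n))
  induction n using Nat.strong_induction_on with
  | _ n ih =>
    rcases Nat.lt_or_ge 2 n with hn | hn
    · obtain ⟨k, rfl⟩ := Nat.exists_eq_add_of_le' hn
      have e : plasticNumber ^ (k + 3) = plasticNumber ^ (k + 1) + plasticNumber ^ k := by
        linear_combination plasticNumber ^ k * plasticNumber_spec.2
      have hc : ((semigroupBall S g h (k + 1)).ncard : ℝ) + (semigroupBall S g h k).ncard ≤
          (semigroupBall S g h (k + 3)).ncard := by
        exact_mod_cast hp.ncard_semigroupBall_le hS hg hh k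
      have := mul_le_mul_of_nonneg_left hc (sq_nonneg plasticNumber)
      change plasticNumber ^ (k + 3) ≤ plasticNumber ^ 2 * (semigroupBall S g h (k + 3)).ncard
      linarith [ih (k + 1) (by omega), ih k (by omega)]
    · exact hsmall n hn

theorem PingPong.plasticNumber_le_growthRate {V : Type*} [MulAction G V] (hp : PingPong V g h)
    (hS : S.Finite) (hg : wordLength S g ≤ (2 : ℕ)) (hh : wordLength S h ≤ (3 : ℕ)) :
    plasticNumber ≤ growthRate S := by
  have h1 := one_lt_plasticNumber
  have h0 : 0 < plasticNumber := by linarith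
  have hlim : Tendsto (fun n : ℕ => plasticNumber * ((plasticNumber ^ 2)⁻¹ : ℝ) ^ (1 / (n : ℝ)))
      atTop (𝓝 (plasticNumber * ((plasticNumber ^ 2)⁻¹ : ℝ) ^ (0 : ℝ))) :=
    (tendsto_const_nhds.rpow tendsto_one_div_atTop_nhds_zero_nat
      (Or.inl (by positivity))).const_mul _
  rw [Real.rpow_zero, mul_one] at hlim
  refine le_of_tendsto_of_tendsto hlim (tendsto_growthRate hS) ?_
  filter_upwards [eventually_gt_atTop 0] with n hn
  have hn' : (n : ℝ) ≠ 0 := by positivity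
  have hle : plasticNumber ^ n * (plasticNumber ^ 2)⁻¹ ≤ growthFunction S n := by
    rw [← div_eq_mul_inv, div_le_iff₀ (by positivity), mul_comm]
    refine (hp.pow_le_ncard_semigroupBall hS hg hh n).trans ?_
    gcongr
    exact_mod_cast Set.ncard_le_ncard (s := semigroupBall S g h n) (fun _ hx => hx.2)
      (finite_wordLength_le hS n)
  calc plasticNumber * ((plasticNumber ^ 2)⁻¹ : ℝ) ^ (1 / (n : ℝ))
      = (plasticNumber ^ n * (plasticNumber ^ 2)⁻¹) ^ (1 / (n : ℝ)) := by
        rw [Real.mul_rpow (by positivity) (by positivity), ← Real.rpow_natCast plasticNumber n,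
          ← Real.rpow_mul h0.le, mul_one_div_cancel hn', Real.rpow_one]
    _ ≤ _ := Real.rpow_le_rpow (by positivity) hle (by positivity)

end Growth

/-! ### Group actions on halfspaces of a tree -/

/-- A `G`-invariant family of halfspaces on a `G`-set, abstracting the halfspaces of a tree on which
`G` acts without inversions. -/
structure IsHalfspaceSystem (G : Type*) {V : Type*} [Group G] [MulAction G V]
    (T : Set (Set V)) : Prop where
  nonempty : ∀ H ∈ T, H.Nonempty
  compl_mem : ∀ H ∈ T, Hᶜ ∈ T
  smul_mem : ∀ (g : G), ∀ H ∈ T, g • H ∈ T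
  nested : ∀ H ∈ T, ∀ K ∈ T, H ⊆ K ∨ K ⊆ H ∨ Disjoint H K ∨ Hᶜ ⊆ K
  finite : ∀ u v : V, {H ∈ T | u ∈ H ∧ v ∉ H}.Finite
  smul_ne_compl : ∀ (g : G), ∀ H ∈ T, g • H ≠ Hᶜ

/-! ### Hyperbolic and elliptic elements and their axes. -/

section Axis

variable {G V : Type*} [Group G] [MulAction G V] {T : Set (Set V)} {g h u : G} {H K : Set V}

/-- The halfspaces that `g` translates strictly into themselves. -/
def forwardAxis (T : Set (Set V)) (g : G) : Set (Set V) := {H ∈ T | g • H ⊂ H}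

/-- The halfspaces bounded by an edge of the axis of `g`. It is empty if and only if `g` is
elliptic. -/
def axis (T : Set (Set V)) (g : G) : Set (Set V) := {H ∈ T | g • H ⊂ H ∨ H ⊂ g • H}

theorem smul_ssubset_smul_iff : g • H ⊂ g • K ↔ H ⊂ K := by
  simp only [ssubset_iff_subset_not_subset, Set.smul_set_subset_smul_set_iff]

theorem inv_smul_ssubset_iff : g⁻¹ • H ⊂ H ↔ H ⊂ g • H := by
  rw [← smul_ssubset_smul_iff (g := g), smul_inv_smul]

theorem ssubset_inv_smul_iff : H ⊂ g⁻¹ • H ↔ g • H ⊂ H := by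
  rw [← smul_ssubset_smul_iff (g := g), smul_inv_smul]

theorem smul_compl_ssubset_iff : g • Hᶜ ⊂ Hᶜ ↔ H ⊂ g • H := by
  rw [Set.smul_set_compl]
  exact compl_lt_compl_iff_lt

theorem compl_ssubset_smul_iff : Hᶜ ⊂ g • Hᶜ ↔ g • H ⊂ H := by
  rw [Set.smul_set_compl]
  exact compl_lt_compl_iff_lt

theorem axis_inv : axis T g⁻¹ = axis T g := by
  ext H
  simp only [axis, Set.mem_ofPred_eq, inv_smul_ssubset_iff, ssubset_inv_smul_iff, or_comm]

theorem forwardAxis_subset_axis : forwardAxis T g ⊆ axis T g := fun _ hH => ⟨hH.1, Or.inl hH.2⟩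

theorem pow_smul_subset {n : ℕ} (hH : g • H ⊆ H) : g ^ n • H ⊆ H := by
  induction n with
  | zero => simp
  | succ n ih =>
    rw [pow_succ, mul_smul]
    exact (Set.smul_set_mono hH).trans ih

theorem mem_forwardAxis_pow (hH : H ∈ forwardAxis T g) {n : ℕ} (hn : 1 ≤ n) :
    H ∈ forwardAxis T (g ^ n) := by
  obtain ⟨k, rfl⟩ := Nat.exists_eq_add_of_le' hn
  refine ⟨hH.1, ?_⟩
  rw [pow_succ', mul_smul]
  exact lt_of_le_of_lt (Set.smul_set_mono (pow_smul_subset hH.2.subset)) hH.2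

namespace IsHalfspaceSystem

variable (hT : IsHalfspaceSystem G T)

section
include hT

theorem compl_mem_axis (hH : H ∈ axis T g) : Hᶜ ∈ axis T g := by
  refine ⟨hT.compl_mem _ hH.1, ?_⟩
  rw [smul_compl_ssubset_iff, compl_ssubset_smul_iff]
  exact hH.2.symm

theorem compl_mem_forwardAxis_inv (hH : H ∈ forwardAxis T g) : Hᶜ ∈ forwardAxis T g⁻¹ :=
  ⟨hT.compl_mem _ hH.1, by rw [smul_compl_ssubset_iff, ssubset_inv_smul_iff]; exact hH.2⟩

theorem mem_axis_iff : H ∈ axis T g ↔ H ∈ forwardAxis T g ∨ Hᶜ ∈ forwardAxis T g := by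
  simp only [axis, forwardAxis, Set.mem_ofPred_eq, smul_compl_ssubset_iff]
  constructor
  · rintro ⟨h1, h2 | h2⟩
    exacts [Or.inl ⟨h1, h2⟩, Or.inr ⟨hT.compl_mem _ h1, h2⟩]
  · rintro (⟨h1, h2⟩ | ⟨h1, h2⟩)
    · exact ⟨h1, Or.inl h2⟩
    · exact ⟨by simpa using hT.compl_mem _ h1, Or.inr h2⟩

theorem axis_conj : axis T (u * g * u⁻¹) = u • axis T g := by
  ext H
  rw [Set.mem_smul_set_iff_inv_smul_mem]
  simp only [axis, Set.mem_ofPred_eq]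
  refine and_congr ⟨hT.smul_mem _ _, fun h => by simpa using hT.smul_mem u _ h⟩ ?_
  rw [← smul_ssubset_smul_iff (g := u) (H := g • u⁻¹ • H),
    ← smul_ssubset_smul_iff (g := u) (K := g • u⁻¹ • H)]
  simp [mul_smul]

theorem exists_notMem (hH : H ∈ T) : ∃ v, v ∉ H := hT.nonempty _ (hT.compl_mem _ hH)

/-- Every point is eventually moved into a halfspace on the forward axis. -/
theorem exists_pow_smul_mem (hH : H ∈ forwardAxis T g) (v : V) :
    ∃ N : ℕ, ∀ n ≥ N, g ^ n • v ∈ H := by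
  have hstep : ∀ n : ℕ, g ^ n • v ∈ H → ∀ m ≥ n, g ^ m • v ∈ H := by
    intro n hn m hm
    obtain ⟨k, rfl⟩ := Nat.exists_eq_add_of_le hm
    rw [add_comm, pow_add, mul_smul]
    exact pow_smul_subset hH.2.subset (Set.smul_mem_smul_set hn)
  by_contra! hc
  have hv : ∀ n : ℕ, g ^ n • v ∉ H := fun n hn => by
    obtain ⟨m, hm, hm'⟩ := hc n
    exact hm' (hstep n hn m hm)
  obtain ⟨w, hw⟩ := hT.nonempty _ hH.1
  -- If the orbit of `v` avoided `H`, infinitely many distinct translates of `H` would contain `w`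
  -- but not `v`.
  have hmono : StrictMono fun n : ℕ => g⁻¹ ^ n • H := strictMono_nat_of_lt_succ fun n => by
    rw [pow_succ, mul_smul]
    exact smul_ssubset_smul_iff.2 (ssubset_inv_smul_iff.2 hH.2)
  refine Set.infinite_of_injective_forall_mem hmono.injective (fun n => ?_) (hT.finite w v)
  refine ⟨hT.smul_mem _ _ hH.1, ?_, ?_⟩
  · have := hmono.monotone (Nat.zero_le n)
    exact this (by simpa using hw)
  · rw [inv_pow, Set.mem_inv_smul_set_iff]
    exact hv n

theorem inter_nonempty_of_mem_forwardAxis (hH : H ∈ forwardAxis T g) (hK : K ∈ forwardAxis T g) :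
    ¬ Disjoint H K := by
  obtain ⟨v, -⟩ := hT.nonempty _ hH.1
  obtain ⟨N, hN⟩ := hT.exists_pow_smul_mem hH v
  obtain ⟨M, hM⟩ := hT.exists_pow_smul_mem hK v
  rw [Set.not_disjoint_iff]
  exact ⟨_, hN (max N M) (le_max_left _ _), hM (max N M) (le_max_right _ _)⟩

/-- Both halfspaces attract all points under `g`, so they meet; both complements attract under
`g⁻¹`, so they meet too. Of the nesting cases only inclusion is left. -/
theorem subset_total_of_mem_forwardAxis (hH : H ∈ forwardAxis T g)
    (hK : K ∈ forwardAxis T g) : H ⊆ K ∨ K ⊆ H := by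
  rcases hT.nested _ hH.1 _ hK.1 with h | h | h | h
  · exact Or.inl h
  · exact Or.inr h
  · exact (hT.inter_nonempty_of_mem_forwardAxis hH hK h).elim
  · refine (hT.inter_nonempty_of_mem_forwardAxis (hT.compl_mem_forwardAxis_inv hH)
      (hT.compl_mem_forwardAxis_inv hK) ?_).elim
    exact Set.disjoint_compl_right_iff_subset.2 h

/-- Pigeonhole: two of the three point in the same direction along the axis, so they meet. -/
theorem false_of_disjoint_mem_axis {H₁ H₂ H₃ : Set V} (h₁ : H₁ ∈ axis T g)
    (h₂ : H₂ ∈ axis T g) (h₃ : H₃ ∈ axis T g) (h₁₂ : Disjoint H₁ H₂) (h₁₃ : Disjoint H₁ H₃)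
    (h₂₃ : Disjoint H₂ H₃) : False := by
  have key : ∀ {H K : Set V}, H ∈ forwardAxis T g → K ∈ forwardAxis T g → ¬ Disjoint H K :=
    fun hH hK => hT.inter_nonempty_of_mem_forwardAxis hH hK
  have key' : ∀ {H K : Set V}, H ∈ forwardAxis T g⁻¹ → K ∈ forwardAxis T g⁻¹ → ¬ Disjoint H K :=
    fun hH hK => hT.inter_nonempty_of_mem_forwardAxis hH hK
  have hor : ∀ {H : Set V}, H ∈ axis T g → H ∈ forwardAxis T g ∨ H ∈ forwardAxis T g⁻¹ :=
    fun hH => (hT.mem_axis_iff.1 hH).imp_right fun h => by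
      simpa using hT.compl_mem_forwardAxis_inv h
  rcases hor h₁ with a | a <;> rcases hor h₂ with b | b <;> rcases hor h₃ with c | c
  exacts [key a b h₁₂, key a b h₁₂, key a c h₁₃, key' b c h₂₃, key b c h₂₃, key' a c h₁₃,
    key' a b h₁₂, key' a b h₁₂]

/-- A hyperbolic element stabilizes no halfspace. -/
theorem smul_ne_self (hK : K ∈ forwardAxis T g) (hH : H ∈ T) : g • H ≠ H := by
  intro he
  have hpow : ∀ n : ℕ, g ^ n • H = H := fun n => by
    induction n with
    | zero => simp
    | succ n ih => rw [pow_succ, mul_smul, he, ih]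
  have hmem : ∀ (n : ℕ) (v : V), g ^ n • v ∈ H ↔ v ∈ H := fun n v => by
    conv_lhs => rw [← hpow n]
    exact Set.smul_mem_smul_set_iff
  have hmem' : ∀ (n : ℕ) (v : V), g⁻¹ ^ n • v ∈ H ↔ v ∈ H := fun n v => by
    rw [← hmem n, inv_pow, smul_inv_smul]
  obtain ⟨v, hv⟩ := hT.nonempty _ hH
  obtain ⟨w, hw⟩ := hT.exists_notMem hH
  obtain ⟨N, hN⟩ := hT.exists_pow_smul_mem hK v
  obtain ⟨N', hN'⟩ := hT.exists_pow_smul_mem hK w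
  obtain ⟨M, hM⟩ := hT.exists_pow_smul_mem (hT.compl_mem_forwardAxis_inv hK) v
  obtain ⟨M', hM'⟩ := hT.exists_pow_smul_mem (hT.compl_mem_forwardAxis_inv hK) w
  -- Powers of `g` keep `v` inside `H` and `w` outside, yet carry both into `K` forwards and into
  -- `Kᶜ` backwards. Each nesting relation contradicts this.
  rcases hT.nested _ hH _ hK.1 with h | h | h | h
  · exact hM M le_rfl (h ((hmem' M v).2 hv))
  · exact hw ((hmem N' w).1 (h (hN' N' le_rfl)))
  · exact Set.disjoint_left.1 h ((hmem N v).2 hv) (hN N le_rfl)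
  · exact hM' M' le_rfl (h (fun hx => hw ((hmem' M' w).1 hx)))

/-- High powers of `g ^ n` carry both `v` and `g • v` into `H`, and `g` maps the first image to the
second. -/
theorem not_disjoint_smul_of_mem_forwardAxis_pow {n : ℕ} (hH : H ∈ forwardAxis T (g ^ n)) :
    ¬ Disjoint (g • H) H := by
  intro hd
  obtain ⟨v, -⟩ := hT.nonempty _ hH.1
  obtain ⟨N, hN⟩ := hT.exists_pow_smul_mem hH v
  obtain ⟨M, hM⟩ := hT.exists_pow_smul_mem hH (g • v)
  refine Set.disjoint_left.1 hd (Set.smul_mem_smul_set (hN (max N M) (le_max_left _ _))) ?_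
  have := hM (max N M) (le_max_right _ _)
  rwa [← pow_mul, ← mul_smul, ← pow_succ, pow_succ', mul_smul, pow_mul] at this

theorem not_disjoint_smul_of_mem_axis_pow {n : ℕ} (hH : H ∈ axis T (g ^ n)) :
    ¬ Disjoint (g • H) H := by
  rcases hT.mem_axis_iff.1 hH with h | h
  · exact hT.not_disjoint_smul_of_mem_forwardAxis_pow h
  · intro hd
    have h' := hT.compl_mem_forwardAxis_inv h
    rw [compl_compl, ← inv_pow] at h'
    refine hT.not_disjoint_smul_of_mem_forwardAxis_pow h' ?_
    rw [Set.disjoint_smul_set_left, inv_inv]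
    exact hd.symm

/-- If `g` is hyperbolic and a halfspace is disjoint from its translate by `g`, it is disjoint from
its translates by all powers of `g`. -/
theorem disjoint_pow_smul (hK : K ∈ forwardAxis T g) (hH : H ∈ T) (hd : Disjoint (g • H) H)
    {n : ℕ} (hn : 1 ≤ n) : Disjoint (g ^ n • H) H := by
  have haxis : ∀ m : ℕ, 1 ≤ m → ¬ g ^ m • H ⊆ H ∧ ¬ H ⊆ g ^ m • H := fun m hm => by
    have hne := hT.smul_ne_self (mem_forwardAxis_pow hK hm) hH
    constructor
    · intro h
      exact hT.not_disjoint_smul_of_mem_axis_pow (n := m) ⟨hH, Or.inl (h.ssubset_of_ne hne)⟩ hd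
    · intro h
      exact hT.not_disjoint_smul_of_mem_axis_pow (n := m)
        ⟨hH, Or.inr (h.ssubset_of_ne hne.symm)⟩ hd
  rcases hT.nested _ (hT.smul_mem (g ^ n) _ hH) _ hH with h | h | h | h
  · exact ((haxis n hn).1 h).elim
  · exact ((haxis n hn).2 h).elim
  · exact h
  -- If the two halfspaces cover everything, the complement of `H`, and with it `g • H`, lies in `g
  -- ^ n • H`; cancelling `g` gives an excluded inclusion for the exponent n - 1.
  · have h' : g • H ⊆ g ^ n • H :=
      (Set.subset_compl_iff_disjoint_right.2 hd).trans (Set.compl_subset_comm.1 h)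
    obtain ⟨k, rfl⟩ := Nat.exists_eq_add_of_le' hn
    rw [pow_succ', mul_smul, Set.smul_set_subset_smul_set_iff] at h'
    rcases Nat.eq_zero_or_pos k with rfl | hk
    · simpa using hd
    · exact ((haxis k hk).2 h').elim

theorem mem_axis_or_disjoint (hK : K ∈ forwardAxis T g) (hH : H ∈ T) :
    H ∈ axis T g ∨ Disjoint (g • H) H ∨ Disjoint (g • Hᶜ) Hᶜ := by
  have hne := hT.smul_ne_self hK hH
  rcases hT.nested _ (hT.smul_mem g _ hH) _ hH with h | h | h | h
  · exact Or.inl ⟨hH, Or.inl (h.ssubset_of_ne hne)⟩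
  · exact Or.inl ⟨hH, Or.inr (h.ssubset_of_ne hne.symm)⟩
  · exact Or.inr (Or.inl h)
  · refine Or.inr (Or.inr ?_)
    rw [Set.smul_set_compl]
    exact Set.disjoint_compl_right_iff_subset.2 h

/-- The trichotomy for elliptic elements. -/
theorem smul_eq_or_subset_compl (hg : axis T g = ∅) (hH : H ∈ T) :
    g • H = H ∨ g • H ⊆ Hᶜ ∨ g • Hᶜ ⊆ H := by
  have hno : ¬ (g • H ⊂ H ∨ H ⊂ g • H) := fun h => by
    have : H ∈ axis T g := ⟨hH, h⟩
    simp [hg] at this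
  push Not at hno
  rcases hT.nested _ (hT.smul_mem g _ hH) _ hH with h | h | h | h
  · exact Or.inl (by_contra fun hne => hno.1 (h.ssubset_of_ne hne))
  · exact Or.inl (by_contra fun hne => hno.2 (h.ssubset_of_ne (Ne.symm hne)))
  · exact Or.inr (Or.inl (Set.disjoint_left.1 h))
  · exact Or.inr (Or.inr (by rwa [Set.smul_set_compl]))

end

end IsHalfspaceSystem

end Axis

namespace IsHalfspaceSystem

/-! ### Ping-pong from halfspaces -/

section PingPong

variable {G V : Type*} [Group G] [MulAction G V] {T : Set (Set V)} {g h u : G} {H K : Set V}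
  (hT : IsHalfspaceSystem G T)
include hT

theorem exists_mem_forwardAxis (hg : (axis T g).Nonempty) : ∃ H, H ∈ forwardAxis T g := by
  obtain ⟨H, hH⟩ := hg
  rcases hT.mem_axis_iff.1 hH with h | h
  exacts [⟨_, h⟩, ⟨_, h⟩]

theorem pow_inv_smul_mem_forwardAxis (hH : H ∈ forwardAxis T g) (n : ℕ) :
    g⁻¹ ^ n • H ∈ forwardAxis T g := by
  refine ⟨hT.smul_mem _ _ hH.1, ?_⟩
  have hc : g * g⁻¹ ^ n = g⁻¹ ^ n * g := ((Commute.refl g).inv_right.pow_right n).eq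
  rw [← mul_smul, hc, mul_smul]
  exact smul_ssubset_smul_iff.2 hH.2

/-- Here D is `H` and E is the union of its translates by positive powers of `h`; `hs` says that `g`
maps E into D. -/
theorem pingPong_of_subset (hH : H ∈ forwardAxis T g) (hd : ∀ n : ℕ, 1 ≤ n → Disjoint (h ^ n • H) H)
    (hs : ∀ n : ℕ, 1 ≤ n → h ^ n • H ⊆ g⁻¹ • H) : PingPong V g h := by
  refine ⟨H, ⋃ n : ℕ, h ^ (n + 1) • H, ?_, hT.nonempty _ hH.1, hH.2.subset, ?_, ?_, ?_⟩
  · exact Set.disjoint_iUnion_right.2 fun n => (hd (n + 1) (by omega)).symm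
  · rw [Set.smul_set_subset_iff_subset_inv_smul_set]
    exact Set.iUnion_subset fun n => hs (n + 1) (by omega)
  · exact Set.subset_iUnion_of_subset 0 (by simp)
  · rw [Set.smul_set_iUnion]
    refine Set.iUnion_subset fun n => Set.subset_iUnion_of_subset (n + 1) ?_
    rw [← mul_smul, ← pow_succ']

/-- Since the sets `g⁻¹ ^ n • H` exhaust `V`, there is a last one, P, disjoint from its
`h`-translate. Then P branches off the axis of `h`, while `g⁻¹ • P` lies on that axis or contains
it. In either case `g⁻¹ • P` contains the translates of P by all positive or by all negative powers
of `h`. -/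
theorem pingPong_of_disjoint (hH : H ∈ forwardAxis T g) (hK : K ∈ forwardAxis T h)
    (hd : Disjoint (h • H) H) : PingPong V g h ∨ PingPong V g h⁻¹ := by
  obtain ⟨n, hn, hn'⟩ : ∃ n : ℕ, Disjoint (h • g⁻¹ ^ n • H) (g⁻¹ ^ n • H) ∧
      ¬ Disjoint (h • g⁻¹ ^ (n + 1) • H) (g⁻¹ ^ (n + 1) • H) := by
    by_contra! hc
    have hall : ∀ n : ℕ, Disjoint (h • g⁻¹ ^ n • H) (g⁻¹ ^ n • H) := fun n => by
      induction n with
      | zero => simpa using hd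
      | succ n ih => exact hc n ih
    obtain ⟨v, -⟩ := hT.nonempty _ hH.1
    obtain ⟨N, hN⟩ := hT.exists_pow_smul_mem hH v
    obtain ⟨M, hM⟩ := hT.exists_pow_smul_mem hH (h • v)
    refine Set.disjoint_left.1 (hall (max N M)) (Set.smul_mem_smul_set (a := h) (b := v) ?_) ?_
    · rw [inv_pow, Set.mem_inv_smul_set_iff]
      exact hN _ (le_max_left _ _)
    · rw [inv_pow, Set.mem_inv_smul_set_iff]
      exact hM _ (le_max_right _ _)
  have hP := hT.pow_inv_smul_mem_forwardAxis hH n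
  rw [pow_succ', mul_smul] at hn'
  generalize g⁻¹ ^ n • H = P at hn hn' hP
  have hPM : P ⊆ g⁻¹ • P := (ssubset_inv_smul_iff.2 hP.2).subset
  have hMT : g⁻¹ • P ∈ T := hT.smul_mem _ _ hP.1
  have hK' := hT.compl_mem_forwardAxis_inv hK
  have hne := hT.nonempty _ hP.1
  have hd1 : ∀ n : ℕ, 1 ≤ n → Disjoint (h ^ n • P) P := fun n => hT.disjoint_pow_smul hK hP.1 hn
  have hd2 : ∀ n : ℕ, 1 ≤ n → Disjoint (h⁻¹ ^ n • P) P := fun n =>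
    hT.disjoint_pow_smul hK' hP.1 (by rw [Set.disjoint_smul_set_left, inv_inv]; exact hn.symm)
  rcases hT.mem_axis_or_disjoint hK hMT with hM | hM | hM
  · rcases hT.mem_axis_iff.1 hM with hM | hM
    · exact Or.inl (hT.pingPong_of_subset hP hd1 fun n _ =>
        (Set.smul_set_mono hPM).trans (pow_smul_subset hM.2.subset))
    · have hM := hT.compl_mem_forwardAxis_inv hM
      rw [compl_compl] at hM
      exact Or.inr (hT.pingPong_of_subset hP hd2 fun n _ =>
        (Set.smul_set_mono hPM).trans (pow_smul_subset hM.2.subset))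
  · exact (hn' hM).elim
  -- The complement of `g⁻¹ • P` now branches off the axis of `h`. If a positive and a negative
  -- power both moved P out of `g⁻¹ • P`, both images would lie in that complement, which would then
  -- meet one of its own translates.
  · have hsub : ∀ f k : G, ¬ f • P ⊆ g⁻¹ • P → ¬ k • P ⊆ g⁻¹ • P → Disjoint (f • P) P →
        Disjoint (f • P) (k • P) → f • P ⊆ (g⁻¹ • P)ᶜ := by
      intro f k hf hk hfP hfk
      rcases hT.nested _ (hT.smul_mem f _ hP.1) _ (hT.compl_mem _ hMT) with h1 | h1 | h1 | h1
      · exact h1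
      · obtain ⟨x, hx, hx'⟩ := Set.not_subset.1 hk
        exact (Set.disjoint_left.1 hfk (h1 hx') hx).elim
      · exact (hf (Set.disjoint_compl_right_iff_subset.1 h1)).elim
      · obtain ⟨x, hx⟩ := hne
        exact (Set.disjoint_left.1 hfP (Set.compl_subset_compl.1 h1 (hPM hx)) hx).elim
    by_contra! hc
    have h1 : ¬ ∀ n : ℕ, 1 ≤ n → h ^ n • P ⊆ g⁻¹ • P :=
      fun hs => hc.1 (hT.pingPong_of_subset hP hd1 hs)
    have h2 : ¬ ∀ n : ℕ, 1 ≤ n → h⁻¹ ^ n • P ⊆ g⁻¹ • P :=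
      fun hs => hc.2 (hT.pingPong_of_subset hP hd2 hs)
    push Not at h1 h2
    obtain ⟨i, hi, hi'⟩ := h1
    obtain ⟨j, hj, hj'⟩ := h2
    have hij : Disjoint (h ^ i • P) (h⁻¹ ^ j • P) := by
      rw [inv_pow, Set.disjoint_smul_set_right, inv_inv, ← mul_smul, ← pow_add, add_comm]
      exact hd1 _ (by omega)
    have hi'' := hsub _ _ hi' hj' (hd1 i hi) hij
    have hj'' := hsub _ _ hj' hi' (hd2 j hj) hij.symm
    obtain ⟨x, hx⟩ := hne
    refine Set.disjoint_left.1 (hT.disjoint_pow_smul hK (hT.compl_mem _ hMT) hM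
      (n := i + j) (by omega)) ?_ (hi'' (Set.smul_mem_smul_set hx))
    have := Set.smul_mem_smul_set (a := h ^ (i + j)) (hj'' (Set.smul_mem_smul_set hx))
    have he : h ^ (i + j) • h⁻¹ ^ j • x = h ^ i • x := by
      rw [pow_add, mul_smul, inv_pow, smul_inv_smul]
    rwa [he] at this

theorem exists_pingPong_of_notMem_axis (hh : (axis T h).Nonempty) (hH : H ∈ axis T g)
    (hH' : H ∉ axis T h) :
    ∃ g' h', (g' = g ∨ g' = g⁻¹) ∧ (h' = h ∨ h' = h⁻¹) ∧ PingPong V g' h' := by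
  obtain ⟨K, hK⟩ := hT.exists_mem_forwardAxis hh
  have key : ∀ g' : G, ∀ H' ∈ axis T g', Disjoint (h • H') H' →
      (∃ g'' h', (g'' = g' ∨ g'' = g'⁻¹) ∧ (h' = h ∨ h' = h⁻¹) ∧ PingPong V g'' h') := by
    intro g' H' hH' hd
    rcases hT.mem_axis_iff.1 hH' with hf | hf
    · rcases hT.pingPong_of_disjoint hf hK hd with hp | hp
      exacts [⟨_, _, Or.inl rfl, Or.inl rfl, hp⟩, ⟨_, _, Or.inl rfl, Or.inr rfl, hp⟩]
    · have hf := hT.compl_mem_forwardAxis_inv hf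
      rw [compl_compl] at hf
      rcases hT.pingPong_of_disjoint hf hK hd with hp | hp
      exacts [⟨_, _, Or.inr rfl, Or.inl rfl, hp⟩, ⟨_, _, Or.inr rfl, Or.inr rfl, hp⟩]
  rcases hT.mem_axis_or_disjoint hK hH.1 with hd | hd | hd
  · exact (hH' hd).elim
  · exact key g H hH hd
  · exact key g Hᶜ (hT.compl_mem_axis hH) hd

theorem exists_pingPong_of_axis_ne (hg : (axis T g).Nonempty) (hh : (axis T h).Nonempty)
    (hne : axis T g ≠ axis T h) :
    ∃ g' h', (g' = g ∨ g' = g⁻¹) ∧ (h' = h ∨ h' = h⁻¹) ∧ PingPong V g' h' := by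
  by_cases hs : axis T g ⊆ axis T h
  · obtain ⟨H, hH, hH'⟩ := Set.not_subset.1 fun hs' => hne (hs.antisymm hs')
    obtain ⟨h', g', hh', hg', hp⟩ := hT.exists_pingPong_of_notMem_axis hg hH hH'
    exact ⟨g', h', hg', hh', hp.symm⟩
  · obtain ⟨H, hH, hH'⟩ := Set.not_subset.1 hs
    exact hT.exists_pingPong_of_notMem_axis hh hH hH'

/-- An elliptic element fixing an edge of the axis of `g` but moving an edge `K` further along
the axis off the axis. -/
theorem pingPong_mul_of_subset (hH : H ∈ forwardAxis T g) (hu : axis T u = ∅) (huH : u • H = H)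
    (hK : K ∈ forwardAxis T g) (hKH : K ⊆ H) (huK : u • K ∉ axis T g) :
    PingPong V g (u * g) := by
  -- Slide `K` back along the axis towards `H` and stop at the last halfspace P that is inside `H`
  -- and is moved off the axis by `u`.
  obtain ⟨n, hn, hn'⟩ : ∃ n : ℕ, (g⁻¹ ^ n • K ⊆ H ∧ u • g⁻¹ ^ n • K ∉ axis T g) ∧
      ¬ (g⁻¹ ^ (n + 1) • K ⊆ H ∧ u • g⁻¹ ^ (n + 1) • K ∉ axis T g) := by
    by_contra! hc
    have hall : ∀ n : ℕ, g⁻¹ ^ n • K ⊆ H ∧ u • g⁻¹ ^ n • K ∉ axis T g := fun n => by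
      induction n with
      | zero => simpa using ⟨hKH, huK⟩
      | succ n ih => exact hc n ih
    obtain ⟨v, hv⟩ := hT.exists_notMem hH.1
    obtain ⟨N, hN⟩ := hT.exists_pow_smul_mem hK v
    refine hv ((hall N).1 ?_)
    rw [inv_pow, Set.mem_inv_smul_set_iff]
    exact hN _ le_rfl
  have hP := hT.pow_inv_smul_mem_forwardAxis hK n
  have hM := hT.pow_inv_smul_mem_forwardAxis hK (n + 1)
  rw [pow_succ', mul_smul] at hn' hM
  generalize g⁻¹ ^ n • K = P at hn hn' hP hM
  obtain ⟨hPH, huP⟩ := hn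
  have helim : ∀ {Q : Set V}, Q ∈ T → u • Q ⊆ Q ∨ Q ⊆ u • Q → u • Q = Q := by
    intro Q hQ hor
    by_contra hne
    have : Q ∈ axis T u :=
      ⟨hQ, hor.imp (fun i => i.ssubset_of_ne hne) (fun i => i.ssubset_of_ne (Ne.symm hne))⟩
    simp [hu] at this
  have huPH : ∀ {Q : Set V}, Q ⊆ H → u • Q ⊆ H := fun hQ => by
    rw [← huH]
    exact Set.smul_set_mono hQ
  obtain ⟨w, hw⟩ := hT.exists_notMem hH.1
  have hneP : u • P ≠ P := fun he => huP (by rw [he]; exact forwardAxis_subset_axis hP)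
  have hdisj : Disjoint P (u • P) := by
    rcases hT.nested _ (hT.smul_mem u _ hP.1) _ hP.1 with h1 | h1 | h1 | h1
    · exact (hneP (helim hP.1 (Or.inl h1))).elim
    · exact (hneP (helim hP.1 (Or.inr h1))).elim
    · exact h1.symm
    · exact (hw (hPH (h1 fun hx => hw (huPH hPH hx)))).elim
  have hPM : P ⊆ g⁻¹ • P := (ssubset_inv_smul_iff.2 hP.2).subset
  -- By maximality, either `g⁻¹ • P` contains `H`, which is fixed by `u`, or `u` keeps it on the
  -- axis and, being elliptic, fixes it. Hence `g` maps `u • P` into P, and P and `u • P` are the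
  -- ping-pong sets.
  have huPM : u • P ⊆ g⁻¹ • P := by
    by_cases hMH : g⁻¹ • P ⊆ H
    · have huM : u • g⁻¹ • P ∈ axis T g := by
        by_contra hc
        exact hn' ⟨hMH, hc⟩
      suffices he : u • g⁻¹ • P = g⁻¹ • P from he ▸ Set.smul_set_mono hPM
      refine helim hM.1 ?_
      rcases hT.mem_axis_iff.1 huM with hf | hf
      · exact hT.subset_total_of_mem_forwardAxis hf hM
      · rcases hT.subset_total_of_mem_forwardAxis hf hH with hs | hs
        · exact (hw (hs fun hx => hw (huPH hMH hx))).elim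
        · obtain ⟨x, hx⟩ := hT.nonempty _ (hT.smul_mem u _ hM.1)
          exact (hs (huPH hMH hx) hx).elim
    · rcases hT.subset_total_of_mem_forwardAxis hM hH with hs | hs
      · exact (hMH hs).elim
      · exact (huPH hPH).trans hs
  have hguP : g • u • P ⊆ P := Set.smul_set_subset_iff_subset_inv_smul_set.2 huPM
  refine ⟨P, u • P, hdisj, hT.nonempty _ hP.1, hP.2.subset, hguP, ?_, ?_⟩
  · rw [mul_smul]
    exact Set.smul_set_mono hP.2.subset
  · rw [mul_smul]
    exact Set.smul_set_mono hguP

/-- Passing to `g⁻¹` and complements reverses the axis, so `K` may be assumed to lie ahead of `H`.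
-/
theorem pingPong_mul (hH : H ∈ axis T g) (hu : axis T u = ∅) (huH : u • H = H)
    (hK : K ∈ axis T g) (huK : u • K ∉ axis T g) :
    PingPong V g (u * g) ∨ PingPong V g⁻¹ (u * g⁻¹) := by
  have huK' : u • Kᶜ ∉ axis T g := fun hc => huK <| by
    rw [Set.smul_set_compl] at hc
    simpa using hT.compl_mem_axis hc
  have huH' : u • Hᶜ = Hᶜ := by rw [Set.smul_set_compl, huH]
  have key : ∀ {H K : Set V}, H ∈ forwardAxis T g → K ∈ forwardAxis T g → u • H = H →
      u • K ∉ axis T g → PingPong V g (u * g) ∨ PingPong V g⁻¹ (u * g⁻¹) := by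
    intro H K hH hK huH huK
    rcases hT.subset_total_of_mem_forwardAxis hK hH with hs | hs
    · exact Or.inl (hT.pingPong_mul_of_subset hH hu huH hK hs huK)
    · refine Or.inr (hT.pingPong_mul_of_subset (hT.compl_mem_forwardAxis_inv hH) hu
        (by rw [Set.smul_set_compl, huH]) (hT.compl_mem_forwardAxis_inv hK)
        (Set.compl_subset_compl.2 hs) fun hc => huK ?_)
      rw [axis_inv, Set.smul_set_compl] at hc
      simpa using hT.compl_mem_axis hc
  rcases hT.mem_axis_iff.1 hH with a | a <;> rcases hT.mem_axis_iff.1 hK with b | b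
  exacts [key a b huH huK, key a b huH huK', key a b huH' huK, key a b huH' huK']

end PingPong

/-! ### Growth of groups acting on trees -/

section Growth

variable {G V : Type*} [Group G] [MulAction G V] {T : Set (Set V)} {X : Set V} {S : Set G}
  (hT : IsHalfspaceSystem G T)
include hT

/-- An axis preserved by all generators is `G`-invariant. Up to complement there is one orbit of
halfspaces, so the axis would be all of `T`, but a line has no three disjoint halfspaces. -/
theorem exists_smul_axis_ne (hX : ∀ H ∈ T, ∃ g : G, H = g • X ∨ H = g • Xᶜ)
    {H₁ H₂ H₃ : Set V} (h₁ : H₁ ∈ T) (h₂ : H₂ ∈ T) (h₃ : H₃ ∈ T) (h₁₂ : Disjoint H₁ H₂)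
    (h₁₃ : Disjoint H₁ H₃) (h₂₃ : Disjoint H₂ H₃) (hgen : Subgroup.closure S = ⊤)
    {g : G} (hg : (axis T g).Nonempty) : ∃ u ∈ S, u • axis T g ≠ axis T g := by
  by_contra! hc
  have hst : ∀ u : G, u • axis T g = axis T g := by
    have : Subgroup.closure S ≤ MulAction.stabilizer G (axis T g) :=
      (Subgroup.closure_le _).2 fun u hu => MulAction.mem_stabilizer_iff.2 (hc u hu)
    rw [hgen] at this
    exact fun u => MulAction.mem_stabilizer_iff.1 (this (Subgroup.mem_top u))
  have hst' : ∀ (u : G), ∀ H ∈ axis T g, u • H ∈ axis T g := fun u H hH => by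
    rw [← hst u]
    exact Set.smul_mem_smul_set hH
  have hXm : X ∈ axis T g := by
    obtain ⟨H, hH⟩ := hg
    obtain ⟨u, rfl | rfl⟩ := hX H hH.1
    · simpa using hst' u⁻¹ _ hH
    · simpa using hT.compl_mem_axis (hst' u⁻¹ _ hH)
  have hall : ∀ H ∈ T, H ∈ axis T g := fun H hH => by
    obtain ⟨u, rfl | rfl⟩ := hX H hH
    exacts [hst' u _ hXm, hst' u _ (hT.compl_mem_axis hXm)]
  exact hT.false_of_disjoint_mem_axis (hall _ h₁) (hall _ h₂) (hall _ h₃) h₁₂ h₁₃ h₂₃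

/-- If all generators are elliptic and there is no global fixed point, then some edge separates
the fixed points of two generators. -/
theorem exists_separating (hX : ∀ H ∈ T, ∃ g : G, H = g • X ∨ H = g • Xᶜ) (hXT : X ∈ T)
    {a b : G} (hb : Disjoint X (b • X)) (ha : Disjoint Xᶜ (a • Xᶜ))
    (hgen : Subgroup.closure S = ⊤) (hell : ∀ s ∈ S, axis T s = ∅) :
    ∃ H ∈ T, ∃ s ∈ S, ∃ t ∈ S, s • Hᶜ ⊆ H ∧ t • H ⊆ Hᶜ := by
  by_contra! hno
  -- U consists of the halfspaces holding the fixed points of some generator that moves the bounding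
  -- edge. Without a separating edge, U picks exactly one side of each edge, is closed upwards and
  -- is `G`-invariant, like a fixed point or fixed end.
  obtain ⟨U, hU⟩ : ∃ U : Set (Set V), ∀ H, H ∈ U ↔ H ∈ T ∧ ∃ s ∈ S, s • Hᶜ ⊆ H :=
    ⟨{H | H ∈ T ∧ ∃ s ∈ S, s • Hᶜ ⊆ H}, fun _ => Iff.rfl⟩
  have hnot : ∀ H ∈ U, Hᶜ ∉ U := by
    intro H hH hH'
    obtain ⟨hHT, s, hs, hsH⟩ := (hU H).1 hH
    obtain ⟨-, t, ht, htH⟩ := (hU _).1 hH'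
    rw [compl_compl] at htH
    exact hno H hHT s hs t ht hsH htH
  have hor : ∀ H ∈ T, H ∈ U ∨ Hᶜ ∈ U := by
    intro H hH
    by_contra! hc
    have hfix : ∀ s ∈ S, s • H = H := by
      intro s hs
      rcases hT.smul_eq_or_subset_compl (hell s hs) hH with h | h | h
      · exact h
      · exact (hc.2 ((hU _).2 ⟨hT.compl_mem _ hH, s, hs, by rwa [compl_compl]⟩)).elim
      · exact (hc.1 ((hU _).2 ⟨hH, s, hs, h⟩)).elim
    have hst : ∀ u : G, u • H = H := by
      have : Subgroup.closure S ≤ MulAction.stabilizer G H :=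
        (Subgroup.closure_le _).2 fun u hu => MulAction.mem_stabilizer_iff.2 (hfix u hu)
      rw [hgen] at this
      exact fun u => MulAction.mem_stabilizer_iff.1 (this (Subgroup.mem_top u))
    have hXb : b • X = X := by
      obtain ⟨u, rfl | rfl⟩ := hX H hH
      · have h1 := hst u⁻¹
        rw [inv_smul_smul] at h1
        rw [h1]
        simpa [← h1] using hst b
      · have h1 := hst u⁻¹
        rw [inv_smul_smul] at h1
        have h2 := hst b
        rw [← h1, Set.smul_set_compl] at h2
        exact compl_injective h2
    rw [hXb, disjoint_self] at hb
    exact (hT.nonempty _ hXT).ne_empty hb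
  have hup : ∀ H ∈ U, ∀ K ∈ T, H ⊆ K → K ∈ U := by
    intro H hH K hK hHK
    obtain ⟨-, s, hs, hsH⟩ := (hU H).1 hH
    exact (hU K).2 ⟨hK, s, hs,
      ((Set.smul_set_mono (Set.compl_subset_compl.2 hHK)).trans hsH).trans hHK⟩
  have hmem : ∀ s ∈ S, ∀ H ∈ U, s • H ∈ U := by
    intro s hs H hH
    obtain ⟨hHT, t, ht, htH⟩ := (hU H).1 hH
    rcases hT.smul_eq_or_subset_compl (hell s hs) hHT with h | h | h
    · rwa [h]
    · exact (hno H hHT t ht s hs htH h).elim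
    · refine (hU _).2 ⟨hT.smul_mem _ _ hHT, s, hs, ?_⟩
      rw [← Set.smul_set_compl]
      exact Set.smul_set_mono h
  have hiff : ∀ s ∈ S, ∀ H ∈ T, s • H ∈ U → H ∈ U := by
    intro s hs H hH hsH
    refine (hor H hH).resolve_right fun hc => hnot _ hsH ?_
    rw [← Set.smul_set_compl]
    exact hmem s hs _ hc
  have hst : ∀ (u : G), ∀ H ∈ U, u • H ∈ U := by
    have : Subgroup.closure S ≤ MulAction.stabilizer G U := by
      refine (Subgroup.closure_le _).2 fun s hs => MulAction.mem_stabilizer_iff.2 ?_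
      ext H
      rw [Set.mem_smul_set_iff_inv_smul_mem]
      constructor
      · intro hH
        simpa using hmem s hs _ hH
      · intro hH
        exact hiff s hs _ (hT.smul_mem _ _ ((hU H).1 hH).1) (by simpa using hH)
    rw [hgen] at this
    intro u H hH
    rw [← MulAction.mem_stabilizer_iff.1 (this (Subgroup.mem_top u))]
    exact Set.smul_mem_smul_set hH
  -- A translate disjoint from `H` would be in U and contained in `Hᶜ`, putting both sides in U. The
  -- elements `a` and `b` provide such translates for both sides of `X`.
  have hcontra : ∀ H ∈ U, ∀ u : G, ¬ Disjoint H (u • H) := by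
    intro H hH u hd
    have h1 := hst u H hH
    exact hnot _ h1 (hup H hH _ (hT.compl_mem _ ((hU _).1 h1).1)
      (Set.subset_compl_iff_disjoint_right.2 hd))
  rcases hor X hXT with h | h
  exacts [hcontra _ h b hb, hcontra _ h a ha]

theorem plasticNumber_le_growthRate (hX : ∀ H ∈ T, ∃ g : G, H = g • X ∨ H = g • Xᶜ)
    (hXT : X ∈ T) {a b c : G} (ha : Disjoint Xᶜ (a • Xᶜ)) (hb : Disjoint X (b • X))
    (hc : Disjoint X (c • X)) (hbc : Disjoint (b • X) (c • X))
    (hS : S.Finite) (hgen : Subgroup.closure S = ⊤) : plasticNumber ≤ growthRate S := by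
  by_contra hlt
  have hNP : ∀ g h : G, wordLength S g ≤ (2 : ℕ) → wordLength S h ≤ (3 : ℕ) →
      ¬ PingPong V g h :=
    fun g h hg hh hp => hlt (hp.plasticNumber_le_growthRate hS hg hh)
  have haxis : ∀ g h : G, wordLength S g ≤ (2 : ℕ) → wordLength S h ≤ (3 : ℕ) →
      (axis T g).Nonempty → (axis T h).Nonempty → axis T g = axis T h := by
    intro g h hg hh hgn hhn
    by_contra hne
    obtain ⟨g', h', hg', hh', hp⟩ := hT.exists_pingPong_of_axis_ne hgn hhn hne
    refine hNP g' h' ?_ ?_ hp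
    · rcases hg' with rfl | rfl
      exacts [hg, wordLength_inv_le hg]
    · rcases hh' with rfl | rfl
      exacts [hh, wordLength_inv_le hh]
  have hmoved : ∀ {g : G}, (axis T g).Nonempty → ∃ u ∈ S, u • axis T g ≠ axis T g := fun hg =>
    hT.exists_smul_axis_ne hX hXT (hT.smul_mem b _ hXT) (hT.smul_mem c _ hXT) hb hc hbc hgen hg
  have hell : ∀ s ∈ S, axis T s = ∅ := by
    intro s hs
    by_contra hne
    have hne := Set.nonempty_iff_ne_empty.2 hne
    obtain ⟨u, hu, hus⟩ := hmoved hne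
    refine hus ?_
    rw [← hT.axis_conj]
    refine (haxis _ _ (wordLength_le_of_le (wordLength_le_one hs) (by norm_num))
      (wordLength_mul_le (wordLength_mul_le (wordLength_le_one hu) (wordLength_le_one hs))
        (wordLength_inv_le (wordLength_le_one hu))) hne ?_).symm
    rw [hT.axis_conj]
    exact hne.smul_set
  obtain ⟨H, hH, s, hs, t, ht, hsH, htH⟩ := hT.exists_separating hX hXT hb ha hgen hell
  have hlen : ∀ {x y : G}, x ∈ S → y ∈ S → wordLength S (x * y) ≤ (2 : ℕ) := fun hx hy =>
    wordLength_mul_le (wordLength_le_one hx) (wordLength_le_one hy)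
  have hsep : ∀ {x y : G} {H : Set V}, H ∈ T → x • Hᶜ ⊆ H → y • H ⊆ Hᶜ → H ∈ axis T (x * y) := by
    intro x y H hH hx hy
    refine ⟨hH, Or.inl ?_⟩
    rw [mul_smul]
    -- Equality would make `x` invert the edge, so the absence of inversions gives strictness.
    refine ((Set.smul_set_mono hy).trans hx).ssubset_of_ne fun he => ?_
    have h1 : x • Hᶜ = H := hx.antisymm (he.symm.subset.trans (Set.smul_set_mono hy))
    exact hT.smul_ne_compl x _ (hT.compl_mem _ hH) (by rw [h1, compl_compl])
  /- Two elliptic generators with disjoint fixed point sets both preserve the axis of their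
  product. -/
  have hpres : ∀ {x y : G} {H : Set V}, x ∈ S → y ∈ S → H ∈ T → x • Hᶜ ⊆ H → y • H ⊆ Hᶜ →
      x • axis T (x * y) = axis T (x * y) ∧ y • axis T (x * y) = axis T (x * y) := by
    intro x y H hx hy hH hxH hyH
    have h1 := hsep hH hxH hyH
    have h2 := hsep (hT.compl_mem _ hH) (by rwa [compl_compl]) (by rwa [compl_compl]) (x := y)
      (y := x)
    -- Conjugating `x * y` by `y`, or by `x⁻¹`, gives `y * x`, so a common axis is preserved by
    -- both.
    have he : axis T (x * y) = axis T (y * x) := haxis _ _ (hlen hx hy)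
      (wordLength_le_of_le (hlen hy hx) (by norm_num)) ⟨_, h1⟩ ⟨_, h2⟩
    constructor
    · conv_lhs => rw [he]
      rw [← hT.axis_conj]
      congr 1
      group
    · rw [← hT.axis_conj, he]
      congr 1
      group
  have hst := hsep hH hsH htH
  obtain ⟨u, hu, hune⟩ := hmoved ⟨_, hst⟩
  have heq : ∀ {x y : G}, x ∈ S → y ∈ S → H ∈ axis T (x * y) →
      axis T (x * y) = axis T (s * t) := fun hx hy hxy =>
    haxis _ _ (hlen hx hy) (wordLength_le_of_le (hlen hs ht) (by norm_num)) ⟨_, hxy⟩ ⟨_, hst⟩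
  rcases hT.smul_eq_or_subset_compl (hell u hu) hH with h | h | h
  · obtain ⟨v, hv, hvH, K, hK, hvK⟩ : ∃ v : G, wordLength S v ≤ (1 : ℕ) ∧ (v • H = H ∧ axis T v = ∅) ∧
        ∃ K ∈ axis T (s * t), v • K ∉ axis T (s * t) := by
      by_contra! hc
      refine hune (Set.Subset.antisymm ?_ ?_)
      · rintro _ ⟨K, hK, rfl⟩
        exact hc u (wordLength_le_one hu) ⟨h, hell u hu⟩ K hK
      · intro K hK
        rw [Set.mem_smul_set_iff_inv_smul_mem]
        refine hc u⁻¹ (wordLength_inv_le (wordLength_le_one hu)) ⟨?_, ?_⟩ K hK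
        · rw [inv_smul_eq_iff, h]
        · rw [axis_inv, hell u hu]
    rcases hT.pingPong_mul hst hvH.2 hvH.1 hK hvK with hp | hp
    · exact hNP _ _ (hlen hs ht) (wordLength_mul_le hv (hlen hs ht)) hp
    · exact hNP _ _ (wordLength_inv_le (hlen hs ht))
        (wordLength_mul_le hv (wordLength_inv_le (hlen hs ht))) hp
  · exact hune (by rw [← heq hs hu (hsep hH hsH h)]; exact (hpres hs hu hH hsH h).2)
  · exact hune (by rw [← heq hu ht (hsep hH h htH)]; exact (hpres hu ht hH h htH).1)

end Growth

end IsHalfspaceSystem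

/-! ### Halfspaces of the Bass-Serre tree of an amalgamated product -/

section Translates

variable {G V : Type*} [Group G] [MulAction G V]

/-- The translates of a set and of its complement form a halfspace system if they are nested,
finitely separating, and the set is not inverted. -/
theorem IsHalfspaceSystem.of_translates {Y : Set V} (hne : Y.Nonempty) (hne' : Yᶜ.Nonempty)
    (hnest : ∀ g : G, g • Y ⊆ Y ∨ Y ⊆ g • Y ∨ Disjoint (g • Y) Y ∨ (g • Y)ᶜ ⊆ Y)
    (hfin : ∀ u v : V, {H | (∃ g : G, H = g • Y) ∧ u ∈ H ∧ v ∉ H}.Finite)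
    (hinv : ∀ g : G, g • Y ≠ Yᶜ) :
    IsHalfspaceSystem G {H | ∃ g : G, H = g • Y ∨ H = g • Yᶜ} where
  nonempty := by
    rintro _ ⟨g, rfl | rfl⟩
    exacts [hne.smul_set, hne'.smul_set]
  compl_mem := by
    rintro _ ⟨g, rfl | rfl⟩
    · exact ⟨g, Or.inr (by rw [Set.smul_set_compl])⟩
    · exact ⟨g, Or.inl (by rw [Set.smul_set_compl, compl_compl])⟩
  smul_mem := by
    rintro h _ ⟨g, rfl | rfl⟩
    · exact ⟨h * g, Or.inl (by rw [mul_smul])⟩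
    · exact ⟨h * g, Or.inr (by rw [mul_smul])⟩
  nested := by
    have key : ∀ g k : G, g • Y ⊆ k • Y ∨ k • Y ⊆ g • Y ∨ Disjoint (g • Y) (k • Y) ∨
        (g • Y)ᶜ ⊆ k • Y := by
      intro g k
      have h := hnest (k⁻¹ * g)
      rw [mul_smul] at h
      rcases h with h | h | h | h
      · exact Or.inl (Set.subset_smul_set_iff.2 h)
      · exact Or.inr (Or.inl (Set.smul_set_subset_iff_subset_inv_smul_set.2 h))
      · exact Or.inr (Or.inr (Or.inl (Set.disjoint_smul_set_right.2 h)))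
      · rw [← Set.smul_set_compl] at h
        exact Or.inr (Or.inr (Or.inr (Set.subset_smul_set_iff.2 h)))
    have hcompl : ∀ A B : Set V, (A ⊆ B ∨ B ⊆ A ∨ Disjoint A B ∨ Aᶜ ⊆ B) →
        (A ⊆ Bᶜ ∨ Bᶜ ⊆ A ∨ Disjoint A Bᶜ ∨ Aᶜ ⊆ Bᶜ) := by
      rintro A B (h | h | h | h)
      · exact Or.inr (Or.inr (Or.inl (Set.disjoint_compl_right_iff_subset.2 h)))
      · exact Or.inr (Or.inr (Or.inr (Set.compl_subset_compl.2 h)))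
      · exact Or.inl (Set.subset_compl_iff_disjoint_right.2 h)
      · exact Or.inr (Or.inl (Set.compl_subset_comm.1 h))
    have hsymm : ∀ A B : Set V, (A ⊆ B ∨ B ⊆ A ∨ Disjoint A B ∨ Aᶜ ⊆ B) →
        (B ⊆ A ∨ A ⊆ B ∨ Disjoint B A ∨ Bᶜ ⊆ A) := by
      rintro A B (h | h | h | h)
      exacts [Or.inr (Or.inl h), Or.inl h, Or.inr (Or.inr (Or.inl h.symm)),
        Or.inr (Or.inr (Or.inr (Set.compl_subset_comm.1 h)))]
    rintro _ ⟨g, rfl | rfl⟩ _ ⟨k, rfl | rfl⟩ <;> try simp only [Set.smul_set_compl]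
    · exact key g k
    · exact hcompl _ _ (key g k)
    · exact hsymm _ _ (hcompl _ _ (key k g))
    · exact hsymm _ _ (hcompl _ _ (hsymm _ _ (hcompl _ _ (key g k))))
  finite u v := by
    refine ((hfin u v).union ((hfin v u).image compl)).subset ?_
    rintro _ ⟨⟨g, rfl | rfl⟩, hu, hv⟩
    · exact Or.inl ⟨⟨g, rfl⟩, hu, hv⟩
    · rw [Set.smul_set_compl] at hu hv ⊢
      exact Or.inr ⟨g • Y, ⟨⟨g, rfl⟩, by simpa using hv, hu⟩, rfl⟩
  smul_ne_compl := by
    rintro h _ ⟨g, rfl | rfl⟩ he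
    · refine hinv (g⁻¹ * h * g) ?_
      rw [mul_smul, mul_smul, he, ← Set.smul_set_compl, inv_smul_smul]
    · refine hinv (g⁻¹ * h * g) ?_
      rw [Set.smul_set_compl, Set.smul_set_compl, compl_compl] at he
      rw [mul_smul, mul_smul, ← compl_compl (h • g • Y), he, Set.smul_set_compl, inv_smul_smul]

end Translates

/-! ### Reduced words in an amalgamated product. -/

namespace Monoid.PushoutI

section StartsWith

variable {F : Bool → Type*} [∀ i, Group (F i)] {C : Type*} [Group C] {φ : ∀ i, C →* F i}

/-- `StartsWith i g` means that `g` is given by a nonempty reduced word whose first letter is in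
the factor with index `i`. -/
inductive StartsWith (φ : ∀ i, C →* F i) : Bool → PushoutI φ → Prop
  | single {i : Bool} (x : F i) (hx : x ∉ (φ i).range) : StartsWith φ i (of i x)
  | cons {i : Bool} (x : F i) (hx : x ∉ (φ i).range) (g : PushoutI φ)
      (hg : StartsWith φ (!i) g) : StartsWith φ i (of i x * g)

theorem mul_map_notMem_range {i : Bool} {x : F i} (hx : x ∉ (φ i).range) (c : C) :
    x * φ i c ∉ (φ i).range := by
  rwa [Subgroup.mul_mem_cancel_right _ (MonoidHom.mem_range.2 ⟨c, rfl⟩)]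

theorem map_mul_notMem_range {i : Bool} {x : F i} (hx : x ∉ (φ i).range) (c : C) :
    φ i c * x ∉ (φ i).range := by
  rwa [Subgroup.mul_mem_cancel_left _ (MonoidHom.mem_range.2 ⟨c, rfl⟩)]

namespace StartsWith

variable {i j : Bool} {g h : PushoutI φ}

theorem exists_word (hg : StartsWith φ i g) :
    ∃ w : CoprodI.Word F, Reduced φ w ∧ w.fstIdx = some i ∧ ofCoprodI w.prod = g := by
  have hone : ∀ {i : Bool} {x : F i}, x ∉ (φ i).range → x ≠ 1 := by
    rintro i _ hx rfl
    exact hx (one_mem _)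
  have hempty : ∀ i, (CoprodI.Word.empty : CoprodI.Word F).fstIdx ≠ some i := fun i => by
    simp [CoprodI.Word.fstIdx, CoprodI.Word.empty]
  induction hg with
  | @single i x hx =>
    refine ⟨CoprodI.Word.cons x .empty (hempty i) (hone hx), ?_, CoprodI.Word.fstIdx_cons .., ?_⟩
    swap
    · rw [CoprodI.Word.prod_cons, CoprodI.Word.prod_empty, mul_one, ofCoprodI_of]
    intro l hl
    simp only [CoprodI.Word.cons, CoprodI.Word.empty, List.mem_singleton] at hl
    subst hl
    exact hx
  | @cons i x hx g hg ih =>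
    obtain ⟨w, hw, hwi, rfl⟩ := ih
    refine ⟨CoprodI.Word.cons x w (by simp [hwi]) (hone hx), ?_, by simp, by simp⟩
    intro l hl
    rcases List.mem_cons.1 hl with rfl | hl
    exacts [hx, hw l hl]

/-- This is where the normal form theorem enters; the other non-membership facts about reduced words
are derived from it. -/
theorem notMem_range_base (hφ : ∀ i, Function.Injective (φ i)) (hg : StartsWith φ i g) :
    g ∉ (base φ).range := by
  intro hmem
  obtain ⟨w, hw, hwi, rfl⟩ := hg.exists_word
  have := hw.eq_empty_of_mem_range hφ hmem
  simp [this, CoprodI.Word.fstIdx, CoprodI.Word.empty] at hwi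

/-- Right multiplication by a factor element changes only the end of the word, so the first letter
survives modulo `C` unless the whole word collapses into `C`. -/
theorem mul_of (hg : StartsWith φ i g) (y : F j) :
    StartsWith φ i (g * of j y) ∨ ∃ c, g * of j y = base φ c ∧ j = i := by
  induction hg with
  | @single i x hx =>
    by_cases hij : j = i
    · subst hij
      rw [← map_mul]
      by_cases hxy : x * y ∈ (φ j).range
      · obtain ⟨c, hc⟩ := hxy
        exact Or.inr ⟨c, by rw [← hc, of_apply_eq_base], rfl⟩
      · exact Or.inl (single _ hxy)
    · left
      obtain rfl : j = !i := by cases i <;> cases j <;> simp_all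
      by_cases hy : y ∈ (φ !i).range
      · obtain ⟨c, rfl⟩ := hy
        rw [of_apply_eq_base, ← of_apply_eq_base φ i, ← map_mul]
        exact single _ (mul_map_notMem_range hx c)
      · exact cons _ hx _ (single _ hy)
  | @cons i x hx g hg ih =>
    left
    rw [mul_assoc]
    rcases ih with ih | ⟨c, hc, -⟩
    · exact cons _ hx _ ih
    · rw [hc, ← of_apply_eq_base φ i, ← map_mul]
      exact single _ (mul_map_notMem_range hx c)

theorem base_mul (hg : StartsWith φ i g) (c : C) : StartsWith φ i (base φ c * g) := by
  cases hg with
  | single x hx =>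
    rw [← of_apply_eq_base φ i, ← map_mul]
    exact single _ (map_mul_notMem_range hx c)
  | cons x hx g hg =>
    rw [← of_apply_eq_base φ i, ← mul_assoc, ← map_mul]
    exact cons _ (map_mul_notMem_range hx c) _ hg

theorem mul_base (hφ : ∀ i, Function.Injective (φ i)) (hg : StartsWith φ i g) (c : C) :
    StartsWith φ i (g * base φ c) := by
  rw [← of_apply_eq_base φ i]
  refine (hg.mul_of _).resolve_right ?_
  rintro ⟨d, hd, -⟩
  refine hg.notMem_range_base hφ ⟨d * c⁻¹, ?_⟩
  rw [map_mul, ← hd, of_apply_eq_base, map_inv, mul_inv_cancel_right]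

/-- Nothing cancels between words with first letters in different factors, so the product is again a
nonempty reduced word. -/
theorem exists_inv_mul (hg : StartsWith φ i g) (hh : StartsWith φ (!i) h) :
    ∃ k, StartsWith φ k (g⁻¹ * h) := by
  induction hg generalizing h with
  | @single i x hx =>
    rw [← map_inv]
    exact ⟨i, cons _ (by rwa [inv_mem_iff]) _ hh⟩
  | @cons i x hx g hg ih =>
    rw [mul_inv_rev, mul_assoc, ← map_inv]
    refine ih ?_
    rw [Bool.not_not]
    exact cons _ (by rwa [inv_mem_iff]) _ hh

theorem not_startsWith_not (hφ : ∀ i, Function.Injective (φ i)) (hg : StartsWith φ i g) :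
    ¬ StartsWith φ (!i) g := by
  intro hg'
  obtain ⟨k, hk⟩ := hg.exists_inv_mul hg'
  rw [inv_mul_cancel] at hk
  exact hk.notMem_range_base hφ (one_mem _)

/-- The index `k` is the factor of the last letter of `g`. -/
theorem exists_last (hg : StartsWith φ i g) :
    ∃ k, ∀ h, StartsWith φ (!k) h → StartsWith φ i (g * h) := by
  induction hg with
  | @single i x hx => exact ⟨i, fun h hh => cons _ hx _ hh⟩
  | @cons i x hx g hg ih =>
    obtain ⟨k, hk⟩ := ih
    exact ⟨k, fun h hh => by rw [mul_assoc]; exact cons _ hx _ (hk h hh)⟩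

end StartsWith

theorem mem_range_base_or_startsWith (g : PushoutI φ) :
    g ∈ (base φ).range ∨ ∃ i, StartsWith φ i g := by
  have hof : ∀ (i : Bool) (y : F i) (g : PushoutI φ),
      (g ∈ (base φ).range ∨ ∃ i, StartsWith φ i g) →
      (g * of i y ∈ (base φ).range ∨ ∃ k, StartsWith φ k (g * of i y)) := by
    rintro i y g (⟨c, rfl⟩ | ⟨k, hk⟩)
    · rw [← of_apply_eq_base φ i, ← map_mul]
      by_cases hy : φ i c * y ∈ (φ i).range
      · obtain ⟨d, hd⟩ := hy
        exact Or.inl ⟨d, by rw [← hd, of_apply_eq_base]⟩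
      · exact Or.inr ⟨i, .single _ hy⟩
    · rcases hk.mul_of y with h | ⟨c, hc, -⟩
      exacts [Or.inr ⟨k, h⟩, Or.inl ⟨c, hc.symm⟩]
  suffices key : ∀ x g : PushoutI φ, (g ∈ (base φ).range ∨ ∃ i, StartsWith φ i g) →
      (g * x ∈ (base φ).range ∨ ∃ k, StartsWith φ k (g * x)) by
    simpa using key g 1 (Or.inl (one_mem _))
  intro x
  induction x using induction_on with
  | of i y => exact hof i y
  | base c =>
    rw [← of_apply_eq_base φ false]
    exact hof _ _
  | mul x y hx hy =>
    intro g hg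
    rw [← mul_assoc]
    exact hy _ (hx g hg)

theorem startsWith_not_or (i : Bool) (g : PushoutI φ) (hg : ¬ StartsWith φ i g) :
    g ∈ (base φ).range ∨ StartsWith φ (!i) g := by
  rcases mem_range_base_or_startsWith g with h | ⟨k, hk⟩
  · exact Or.inl h
  · obtain rfl : k = !i := by
      cases i <;> cases k <;> simp_all
    exact Or.inr hk

theorem of_mul_startsWith {i : Bool} {x : F i} (hx : x ∉ (φ i).range) {g : PushoutI φ}
    (hg : ¬ StartsWith φ i g) : StartsWith φ i (of i x * g) := by
  rcases startsWith_not_or i g hg with ⟨c, rfl⟩ | h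
  · rw [← of_apply_eq_base φ i, ← map_mul]
    exact .single _ (mul_map_notMem_range hx c)
  · exact .cons _ hx _ h

/-- A reduced word starting in factor `j` maps one of the two halfspaces at the base edge into the
set of words starting in factor `j`. -/
theorem StartsWith.forall_mul_or (hφ : ∀ i, Function.Injective (φ i)) {j : Bool}
    {g : PushoutI φ} (hg : StartsWith φ j g) (i : Bool) :
    (∀ h, StartsWith φ i h → StartsWith φ j (g * h)) ∨
      ∀ h, ¬ StartsWith φ i h → StartsWith φ j (g * h) := by
  obtain ⟨k, hk⟩ := hg.exists_last
  by_cases hki : k = i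
  · subst hki
    refine Or.inr fun h hh => ?_
    rcases startsWith_not_or k h hh with ⟨c, rfl⟩ | hh
    exacts [hg.mul_base hφ c, hk h hh]
  · obtain rfl : i = !k := by cases i <;> cases k <;> simp_all
    exact Or.inl hk

/-- For `g` outside `C`, whether its first and last letters lie in factor `i` decides which of the
four relations holds. -/
theorem smul_startsWith_nested (hφ : ∀ i, Function.Injective (φ i)) (i : Bool) (g : PushoutI φ) :
    g • {x | StartsWith φ i x} ⊆ {x | StartsWith φ i x} ∨
    {x | StartsWith φ i x} ⊆ g • {x | StartsWith φ i x} ∨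
    Disjoint (g • {x | StartsWith φ i x}) {x | StartsWith φ i x} ∨
    (g • {x | StartsWith φ i x})ᶜ ⊆ {x | StartsWith φ i x} := by
  have hout : ∀ {j : Bool} {x : PushoutI φ}, j ≠ i → StartsWith φ j x → ¬ StartsWith φ i x := by
    intro j x hj hx
    obtain rfl : i = !j := by cases i <;> cases j <;> simp_all
    exact hx.not_startsWith_not hφ
  rcases mem_range_base_or_startsWith g with ⟨c, rfl⟩ | ⟨j, hj⟩
  · left
    rintro _ ⟨x, hx, rfl⟩
    exact hx.base_mul c
  · rcases hj.forall_mul_or hφ i with h | h <;> by_cases hji : j = i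
    · subst hji
      left
      rintro _ ⟨x, hx, rfl⟩
      exact h x hx
    · refine Or.inr (Or.inr (Or.inl (Set.disjoint_left.2 ?_)))
      rintro _ ⟨x, hx, rfl⟩
      exact hout hji (h x hx)
    · subst hji
      refine Or.inr (Or.inr (Or.inr ?_))
      rw [← Set.smul_set_compl]
      rintro _ ⟨x, hx, rfl⟩
      exact h x hx
    · refine Or.inr (Or.inl (Set.compl_subset_compl.1 ?_))
      rw [← Set.smul_set_compl]
      rintro _ ⟨x, hx, rfl⟩
      exact hout hji (h x hx)

/-- A step from `u` to `u * of j y` leaves at most one translate, that by `u * of j y` itself, since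
`C` stabilizes the halfspace. A general element is reached in finitely many such steps. -/
theorem finite_separating (i : Bool) (u v : PushoutI φ) :
    {H | (∃ g : PushoutI φ, H = g • {x | StartsWith φ i x}) ∧ u ∈ H ∧ v ∉ H}.Finite := by
  have hof : ∀ (j : Bool) (y : F j) (u : PushoutI φ),
      {H | (∃ g : PushoutI φ, H = g • {x | StartsWith φ i x}) ∧ u ∈ H ∧ u * of j y ∉ H}.Finite := by
    intro j y u
    refine (Set.finite_singleton ((u * of j y) • {x | StartsWith φ i x})).subset ?_
    rintro _ ⟨⟨g, rfl⟩, hu, hv⟩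
    rw [Set.mem_smul_set_iff_inv_smul_mem, smul_eq_mul] at hu hv
    rw [← mul_assoc] at hv
    obtain ⟨c, hc, -⟩ := (StartsWith.mul_of hu y).resolve_left hv
    obtain rfl : g = u * of j y * base φ c⁻¹ := by
      rw [map_inv, ← hc]
      group
    rw [Set.mem_singleton_iff, mul_smul]
    congr 1
    ext x
    rw [Set.mem_smul_set_iff_inv_smul_mem, smul_eq_mul, ← map_inv]
    refine ⟨fun hx => ?_, fun hx => StartsWith.base_mul hx _⟩
    have := StartsWith.base_mul hx c⁻¹
    rwa [← mul_assoc, ← map_mul, inv_inv, inv_mul_cancel, map_one, one_mul] at this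
  suffices key : ∀ x u : PushoutI φ, {H | (∃ g : PushoutI φ, H = g • {x | StartsWith φ i x}) ∧
      u ∈ H ∧ u * x ∉ H}.Finite by simpa using key (u⁻¹ * v) u
  intro x
  induction x using induction_on with
  | of j y => exact hof j y
  | base c =>
    rw [← of_apply_eq_base φ false]
    exact hof _ _
  | mul x y hx hy =>
    intro u
    refine ((hx u).union (hy (u * x))).subset ?_
    rintro H ⟨hH, hu, hv⟩
    rw [← mul_assoc] at hv
    by_cases h : u * x ∈ H
    exacts [Or.inr ⟨hH, h, hv⟩, Or.inl ⟨hH, hu, h⟩]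

/-- The third coset is essential: if `C` had index 2 in factor `i`, any element of that factor
outside `C` would exchange this set and its complement. -/
theorem smul_startsWith_ne_compl (hφ : ∀ i, Function.Injective (φ i)) {i : Bool} {y z : F i}
    (hy : y ∉ (φ i).range) (hz : z ∉ (φ i).range) (hyz : y⁻¹ * z ∉ (φ i).range)
    (g : PushoutI φ) : g • {x | StartsWith φ i x} ≠ {x | StartsWith φ i x}ᶜ := by
  intro he
  have hone : ∀ j, ¬ StartsWith φ j (1 : PushoutI φ) := fun j h =>
    h.notMem_range_base hφ (one_mem _)
  have hg : ∀ x, StartsWith φ i (g * x) ↔ ¬ StartsWith φ i x := fun x => by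
    have : g * x ∈ g • {x | StartsWith φ i x} ↔ StartsWith φ i x := Set.smul_mem_smul_set_iff
    rw [← this, he]
    simp
  -- Among the cosets of `y` and `z`, at least one differs from that of `x`.
  have hw : ∀ x : F i, ∃ w : F i, w ∉ (φ i).range ∧ x⁻¹ * w ∉ (φ i).range := fun x => by
    by_cases h : x⁻¹ * y ∈ (φ i).range
    · refine ⟨z, hz, fun h' => hyz ?_⟩
      simpa [mul_assoc] using mul_mem (inv_mem h) h'
    · exact ⟨y, hy, h⟩
  have hgi : StartsWith φ i g := by simpa using (hg 1).2 (hone i)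
  have hinv : StartsWith φ i g⁻¹ := by
    by_contra h
    have := (hg g⁻¹).2 h
    rw [mul_inv_cancel] at this
    exact hone i this
  cases hgi with
  | single x hx =>
    obtain ⟨w, hw, hxw⟩ := hw x
    refine (hg (of i (x⁻¹ * w))).1 ?_ (.single _ hxw)
    rw [← map_mul, mul_inv_cancel_left]
    exact .single _ hw
  | cons x hx g hg' =>
    have hxinv : g * (of i x * g)⁻¹ = of i x⁻¹ := by
      rw [mul_inv_rev, mul_inv_cancel_left, map_inv]
    rcases hg'.forall_mul_or hφ i with h | h
    · have h1 := h _ hinv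
      rw [hxinv] at h1
      exact (StartsWith.single x⁻¹ (by rwa [inv_mem_iff])).not_startsWith_not hφ h1
    · obtain ⟨w, hw, hxw⟩ := hw x
      have h1 := h ((of i x * g)⁻¹ * of i w)
        ((hg _).1 (by rw [mul_inv_cancel_left]; exact .single _ hw))
      rw [← mul_assoc, hxinv, ← map_mul] at h1
      exact (StartsWith.single _ hxw).not_startsWith_not hφ h1

theorem isHalfspaceSystem (hφ : ∀ i, Function.Injective (φ i)) {i : Bool} {y z : F i}
    (hy : y ∉ (φ i).range) (hz : z ∉ (φ i).range) (hyz : y⁻¹ * z ∉ (φ i).range) :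
    IsHalfspaceSystem (PushoutI φ) {H | ∃ g : PushoutI φ, H = g • {x | StartsWith φ i x} ∨
      H = g • {x | StartsWith φ i x}ᶜ} :=
  .of_translates ⟨_, .single y hy⟩
    ⟨1, fun h => StartsWith.notMem_range_base hφ h (one_mem _)⟩
    (smul_startsWith_nested hφ i) (finite_separating i) (smul_startsWith_ne_compl hφ hy hz hyz)

/-- The growth bound for an amalgamated product of two groups over a subgroup which has index at
least `3` in one of them and is proper in the other. -/
theorem plasticNumber_le_growthRate (hφ : ∀ i, Function.Injective (φ i)) {i : Bool}
    {x : F (!i)} {y z : F i} (hx : x ∉ (φ !i).range)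
    (hy : y ∉ (φ i).range) (hz : z ∉ (φ i).range) (hyz : y⁻¹ * z ∉ (φ i).range)
    {S : Set (PushoutI φ)} (hS : S.Finite) (hgen : Subgroup.closure S = ⊤) :
    plasticNumber ≤ growthRate S := by
  have hdisj : ∀ {w : F i}, w ∉ (φ i).range →
      Disjoint {x | StartsWith φ i x}ᶜ ((of i w : PushoutI φ) • {x | StartsWith φ i x}ᶜ) := by
    intro w hw
    refine Set.disjoint_compl_left_iff_subset.2 ?_
    rintro _ ⟨g, hg, rfl⟩
    exact of_mul_startsWith hw hg
  -- The base halfspace is the complement: its translates by 1, `y` and `z` are disjoint, lying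
  -- behind three edges at one vertex. The letter `x` from the other factor moves the opposite
  -- halfspace off itself.
  refine (isHalfspaceSystem hφ hy hz hyz).plasticNumber_le_growthRate
    (X := {x | StartsWith φ i x}ᶜ) (a := (of (!i) x : PushoutI φ)) (b := of i y) (c := of i z) ?_ ?_ ?_
    (hdisj hy) (hdisj hz) ?_ hS hgen
  · rintro H ⟨g, h | h⟩
    exacts [⟨g, Or.inr (by rwa [compl_compl])⟩, ⟨g, Or.inl h⟩]
  · exact ⟨1, Or.inr (by rw [one_smul])⟩
  · rw [compl_compl, Set.disjoint_right]
    rintro _ ⟨g, hg, rfl⟩ hxg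
    exact StartsWith.not_startsWith_not hφ hxg (.cons x hx g (by rwa [Bool.not_not]))
  · have := hdisj hyz
    rwa [map_mul, mul_smul, map_inv, Set.disjoint_smul_set_right, inv_inv] at this

end StartsWith

end Monoid.PushoutI

/-! ### From the index condition to coset representatives, and the main theorem. -/

theorem exists_notMem_of_two_le_card_sub_one {A : Type*} [Group A] {K : Subgroup A}
    (h : 2 ≤ ENat.card (A ⧸ K) - 1) : ∃ y z : A, y ∉ K ∧ z ∉ K ∧ y⁻¹ * z ∉ K := by
  by_contra! hc
  have hcard : ENat.card (A ⧸ K) ≤ 2 := by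
    by_cases hK : ∃ y, y ∉ K
    · obtain ⟨y, hy⟩ := hK
      rw [← Set.encard_univ]
      have hpair : ({((1 : A) : A ⧸ K), (y : A ⧸ K)} : Set (A ⧸ K)).encard ≤ 2 := by
        refine (Set.encard_insert_le _ _).trans ?_
        rw [Set.encard_singleton, one_add_one_eq_two]
      refine le_trans (Set.encard_le_encard fun q _ => ?_) hpair
      induction q using QuotientGroup.induction_on with
      | H z =>
        by_cases hz : z ∈ K
        · exact Or.inl (QuotientGroup.eq.2 (by simpa using hz))
        · exact Or.inr (QuotientGroup.eq.2 (by simpa using inv_mem (hc y z hy hz)))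
    · push Not at hK
      obtain rfl : K = ⊤ := eq_top_iff.2 fun y _ => hK y
      exact ((ENat.card_le_one_iff_subsingleton _).2
        QuotientGroup.subsingleton_quotient_top).trans (by norm_num)
  have h1 : (2 : ℕ∞) - 1 = 1 := by exact_mod_cast (ENat.natCast_sub 2 1).symm
  have h2 := h.trans (tsub_le_tsub_right hcard 1)
  rw [h1] at h2
  exact absurd h2 (by norm_num)

theorem exists_notMem_of_card_sub_one_ne_zero {A : Type*} [Group A] {K : Subgroup A}
    (h : ENat.card (A ⧸ K) - 1 ≠ 0) : ∃ x, x ∉ K := by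
  by_contra! hc
  obtain rfl : K = ⊤ := eq_top_iff.2 fun y _ => hc y
  exact h (tsub_eq_zero_of_le ((ENat.card_le_one_iff_subsingleton _).2
    QuotientGroup.subsingleton_quotient_top))

theorem theorem2 {A B : Type u} {C : Type v} [Group A] [Group B] [Group C]
    (φ : C →* A) (ψ : C →* B) (hφ : Function.Injective φ) (hψ : Function.Injective ψ)
    (hG : Group.FG (AmalgamatedProduct φ ψ))
    (hindex : 2 ≤ (ENat.card (A ⧸ φ.range) - 1) * (ENat.card (B ⧸ ψ.range) - 1)) :
    plasticNumber ≤ minGrowthRate (AmalgamatedProduct φ ψ) := by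
  have hinj : ∀ b, Function.Injective (amalgamMap φ ψ b) := fun b => by
    cases b
    exacts [hφ, hψ]
  have hA : ENat.card (A ⧸ φ.range) - 1 ≠ 0 := by
    intro h
    simp [h] at hindex
  have hB : ENat.card (B ⧸ ψ.range) - 1 ≠ 0 := by
    intro h
    simp [h] at hindex
  refine le_csInf ?_ ?_
  -- The real infimum of an empty set is 0, so finite generation is needed for the set of rates to
  -- be nonempty.
  · obtain ⟨S, hS⟩ := Group.fg_def.1 hG
    exact ⟨_, S, S.finite_toSet, hS, rfl⟩
  rintro _ ⟨S, hS, hgen, rfl⟩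
  -- A product of at least 2 in `ℕ∞` has both factors nonzero and one of them at least 2; that
  -- factor supplies three cosets and the other a proper inclusion.
  rcases lt_or_ge (ENat.card (A ⧸ φ.range) - 1) 2 with h | h
  · have h1 : ENat.card (A ⧸ φ.range) - 1 ≤ 1 := Order.le_of_lt_add_one (by rwa [one_add_one_eq_two])
    have h2 : 2 ≤ ENat.card (B ⧸ ψ.range) - 1 :=
      hindex.trans ((mul_le_mul_left h1 _).trans (one_mul _).le)
    obtain ⟨x, hx⟩ := exists_notMem_of_card_sub_one_ne_zero hA
    obtain ⟨y, z, hy, hz, hyz⟩ := exists_notMem_of_two_le_card_sub_one h2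
    exact Monoid.PushoutI.plasticNumber_le_growthRate (φ := amalgamMap φ ψ) hinj (i := true)
      (x := x) (y := y) (z := z) hx hy hz hyz hS hgen
  · obtain ⟨x, hx⟩ := exists_notMem_of_card_sub_one_ne_zero hB
    obtain ⟨y, z, hy, hz, hyz⟩ := exists_notMem_of_two_le_card_sub_one h
    exact Monoid.PushoutI.plasticNumber_le_growthRate (φ := amalgamMap φ ψ) hinj (i := false)
      (x := x) (y := y) (z := z) hx hy hz hyz hS hgen
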